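/- Let $\mathcal X$ be a standard Borel space (e.g. a Borel subset of $\mathbb R^m$), let $\mathcal A$ be a countable discrete space, and consider a discounted MDP with transition kernel $P_{x,a}\in\mathcal P(\mathcal X)$, bounded measurable reward $r:\mathcal X\times\mathcal A\to\mathbb R$ and discount factor $\gamma\in(0,1)$. A policy is a probability kernel from $\mathcal X$ to $\mathcal A$. Fix a reference policy $\pi^{\rm ref}$. For a policy $\pi$ let $\zeta^\pi_{x,a}$ be the law of $\sum_{t\ge 0}\gamma^t r(X_t,A_t)$ under $\pi$ given $X_0=x$, $A_0=a$, and let $q^\pi(x,a)$ be its mean. For $\tau>0$ and $q:\mathcal X\times\mathcal A\to\mathbb R$ put $(V_\tau q)(x)=\tau\log\int e^{q(x,a)/\tau}\,d\pi^{\rm ref}_x(a)$ and define the Boltzmann–Gibbs policy by $d(\mathrm{BG}_\tau q)_x(a)=e^{(q(x,a)-(V_\tau q)(x))/\tau}\,d\pi^{\rm ref}_x(a)$. Let $q^\star_\tau$ be the unique bounded measurable solution of $q(x,a)=r(x,a)+\gamma\int V_\tau q\,dP_{x,a}$, and let $q^\star_{\rm ref}$ be the unique bounded measurable solution of $q(x,a)=r(x,a)+\gamma\int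 \operatorname{ess\,sup}_{\pi^{\rm ref}_{x'}}q(x',\cdot)\,dP_{x,a}(x')$. A policy $\pi$ is $\varepsilon$-reference-optimal if $q^\pi\ge q^\star_{\rm ref}-\varepsilon$ everywhere. The optimality-filtered reference policy $\bar\pi^\star$ is, at each state $x$, the measure $\pi^{\rm ref}_x$ restricted to $\{a: q^\star_{\rm ref}(x,a)=\operatorname{ess\,sup}_{\pi^{\rm ref}_x}q^\star_{\rm ref}(x,\cdot)\}$ and normalized. For a policy $\pi$ and a probability kernel $\zeta$ from $\mathcal X\times\mathcal A$ to $\mathbb R$, let $(\mathcal T^\pi_\tau\zeta)_{x,a}$ be the law of $r(x,a)+\gamma Z-\gamma\tau\,\mathrm{KL}(\pi_{X'}\,\|\,\pi^{\rm ref}_{X'})$, where $X'\sim P_{x,a}$, $A'\sim\pi_{X'}$, $Z\sim\zeta_{X',A'}$. Let $(Q\zeta)(x,a)$ be the mean of $\zeta_{x,a}$ and let $\mathcal T^\star_\tau\zeta=\mathcal T_\tau^{\mathrm{BG}_\tau Q\zeta}\zeta$. With $W_p$ the $p$-Wasserstein distance on $\mathbb R$ and $\varpi\in\mathcal P(\mathcal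 X\times\mathcal A)$, put $\bar w_{p,p'}(\zeta,\zeta')=\big(\int W_p(\zeta_{x,a},\zeta'_{x,a})^{p'}\,d\varpi(x,a)\big)^{1/p'}$. Assume that there is a constant $p_{\min}>0$ such that $$\pi^{\rm ref}_x\big(\{a: q^\star_\tau(x,a)=\operatorname{ess\,sup}_{\pi^{\rm ref}_x}q^\star_\tau(x,\cdot)\}\big)\ge p_{\min}\qquad\text{for all }\tau>0,\ x\in\mathcal X.$$ Let $p,p'\in[1,\infty)$, let $\varpi\in\mathcal P(\mathcal X\times\mathcal A)$, let $\varepsilon,\delta>0$, and let $\zeta^0$ be a probability kernel from $\mathcal X\times\mathcal A$ to $\mathbb R$ with $\sup_{x,a}\int|z|^p\,d\zeta^0_{x,a}(z)<\infty$. Let $\tau\mapsto\sigma_\tau>0$ be any temperature decoupling, that is, $\sigma_\tau/\tau\to0$ as $\tau\downarrow0$. Then there are $\tau>0$ and $n_{\rm opt},n_{\rm eval}\in\mathbb N$ such that, with $\zeta^{n+1}=\mathcal T^\star_{\sigma_\tau}\zeta^n$, $\hat\pi=\mathrm{BG}_\tau Q\zeta^{n_{\rm opt}}$, $\hat\zeta^0=\zeta^{n_{\rm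 opt}}$ and $\hat\zeta^{n+1}=\mathcal T^{\hat\pi}_\tau\hat\zeta^n$, $$\bar w_{p,p'}\big(\hat\zeta^{n_{\rm eval}},\zeta^{\bar\pi^\star}\big)\le\delta\quad\text{and}\quad \mathrm{BG}_\tau Q\hat\zeta^{n_{\rm eval}}\ \text{is }\varepsilon\text{-reference-optimal}.$$ -/

import Mathlib

open MeasureTheory ProbabilityTheory Filter Topology
open scoped ENNReal

noncomputable section

/-- The `p`-Wasserstein distance between two measures on the real line, as an infimum over
couplings (it is `⊤` if there is no coupling of finite cost). -/
def wass (p : ℝ) (μ ν : Measure ℝ) : ℝ≥0∞ :=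
  (⨅ (κ : Measure (ℝ × ℝ)) (_ : κ.map Prod.fst = μ ∧ κ.map Prod.snd = ν),
    ∫⁻ z, ENNReal.ofReal (|z.1 - z.2| ^ p) ∂κ) ^ (1 / p)

/-- The averaged Wasserstein distance `(∫ W_p(ζ_y, ζ'_y)^q dϖ(y))^(1/q)` between two kernels. -/
def avgWass {Y : Type*} [MeasurableSpace Y] (p q : ℝ) (ϖ : Measure Y) (ζ ζ' : Kernel Y ℝ) :
    ℝ≥0∞ :=
  (∫⁻ y, wass p (ζ y) (ζ' y) ^ q ∂ϖ) ^ (1 / q)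

/-- Probability kernels into `ℝ` whose `p`-th absolute moments are uniformly bounded. -/
def HasBoundedMoment {Y : Type*} [MeasurableSpace Y] (p : ℝ) (ζ : Kernel Y ℝ) : Prop :=
  IsMarkovKernel ζ ∧ (⨆ y, ∫⁻ z, ENNReal.ofReal (|z| ^ p) ∂(ζ y)) < ⊤

/-- The mean function `(x, a) ↦ E_{Z ∼ ζ_{x,a}}[Z]`. -/
def meanFn {Y : Type*} [MeasurableSpace Y] (ζ : Kernel Y ℝ) (y : Y) : ℝ := ∫ z, z ∂(ζ y)

/-- Membership in `M_b`: bounded measurable real functions. -/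
def BddMeasurable {Y : Type*} [MeasurableSpace Y] (f : Y → ℝ) : Prop :=
  Measurable f ∧ ∃ C, ∀ y, |f y| ≤ C

/-- A discounted Markov decision process with states `X` and actions `A`. -/
structure MDP (X A : Type*) [MeasurableSpace X] [MeasurableSpace A] where
  /-- transition kernel -/
  P : Kernel (X × A) X
  /-- reward function -/
  r : X × A → ℝ
  /-- discount factor -/
  γ : ℝ
  markov_P : IsMarkovKernel P
  bddMeasurable_r : BddMeasurable r
  γ_pos : 0 < γ
  γ_lt_one : γ < 1

namespace MDP

variable {X A : Type*} [MeasurableSpace X] [MeasurableSpace A]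

/-- The state-action transition kernel of a policy `π`: from `(x, a)` draw `x' ∼ P_{x,a}` and then
`a' ∼ π_{x'}`. -/
def stepKernel (M : MDP X A) (π : Kernel X A) : Kernel (X × A) (X × A) :=
  M.P.compProd (Kernel.prodMkLeft (X × A) π)

theorem isMarkovKernel_stepKernel (M : MDP X A) (π : Kernel X A) [IsMarkovKernel π] :
    IsMarkovKernel (M.stepKernel π) := by
  have := M.markov_P
  unfold stepKernel
  infer_instance

/-- The transition kernel of a policy, as a kernel on histories up to time `n` that looks at the
last state-action pair only. -/
def historyKernel (M : MDP X A) (π : Kernel X A) (n : ℕ) :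
    Kernel ((_ : Finset.Iic n) → X × A) (X × A) :=
  (M.stepKernel π).comap (fun h => h ⟨n, Finset.mem_Iic.2 le_rfl⟩) (measurable_pi_apply _)

theorem isMarkovKernel_historyKernel (M : MDP X A) (π : Kernel X A) [IsMarkovKernel π] (n : ℕ) :
    IsMarkovKernel (M.historyKernel π n) := by
  have := M.isMarkovKernel_stepKernel π
  unfold historyKernel
  infer_instance

/-- The law of the state-action trajectory `(X_t, A_t)_{t ≥ 0}` under a policy `π`, given
`(X_0, A_0)`. -/
def trajectory (M : MDP X A) (π : Kernel X A) [IsMarkovKernel π] :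
    Kernel (X × A) (ℕ → X × A) :=
  haveI := M.isMarkovKernel_historyKernel π
  (Kernel.traj (X := fun _ => X × A) (M.historyKernel π) 0).comap
    (fun s _ => s) (measurable_pi_lambda _ fun _ => measurable_id)

/-- The discounted return of a trajectory. -/
def discountedReturn (M : MDP X A) (ω : ℕ → X × A) : ℝ := ∑' t : ℕ, M.γ ^ t * M.r (ω t)

open Classical in
/-- The return distribution function `ζ^π` of a policy: `ζ^π_{x,a}` is the law of
`∑ γ^t r(X_t, A_t)` given `X_0 = x`, `A_0 = a`. (Junk value `0` if `π` is not a probability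
kernel.) -/
def returnDist (M : MDP X A) (π : Kernel X A) : Kernel (X × A) ℝ :=
  if _h : IsMarkovKernel π then (M.trajectory π).map M.discountedReturn else 0

/-- The action-value function `q^π` of a policy. -/
def actionValue (M : MDP X A) (π : Kernel X A) : X × A → ℝ := meanFn (M.returnDist π)

/-- The log-partition function `(V_τ q)(x) = τ log ∫ exp(q(x,a)/τ) dπref_x(a)`. -/
def softValue (πref : Kernel X A) (τ : ℝ) (q : X × A → ℝ) (x : X) : ℝ :=
  τ * Real.log (∫ a, Real.exp (q (x, a) / τ) ∂(πref x))

/-- The Boltzmann-Gibbs policy of `q` at temperature `τ`, which has density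
`exp((q(x,a) - (V_τ q)(x))/τ)` with respect to `πref_x`. -/
def boltzmann (πref : Kernel X A) [IsMarkovKernel πref] (τ : ℝ) (q : X × A → ℝ) : Kernel X A :=
  Kernel.withDensity πref fun x a =>
    ENNReal.ofReal (Real.exp ((q (x, a) - softValue πref τ q x) / τ))

/-- The soft Bellman optimality operator at temperature `τ`. -/
def softBellman (M : MDP X A) (πref : Kernel X A) (τ : ℝ) (q : X × A → ℝ) (s : X × A) : ℝ :=
  M.r s + M.γ * ∫ x', softValue πref τ q x' ∂(M.P s)

/-- The Bellman reference-optimality operator. -/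
def refBellman (M : MDP X A) (πref : Kernel X A) (q : X × A → ℝ) (s : X × A) : ℝ :=
  M.r s + M.γ * ∫ x', essSup (fun a' => q (x', a')) (πref x') ∂(M.P s)

/-- The soft optimal action-value function `q*_τ`: the (unique) bounded measurable fixed point of
the soft Bellman optimality operator. -/
def qSoft (M : MDP X A) (πref : Kernel X A) (τ : ℝ) : X × A → ℝ :=
  Classical.epsilon fun q => BddMeasurable q ∧ M.softBellman πref τ q = q

/-- The reference-optimal action-value function: the (unique) bounded measurable fixed point of
the Bellman reference-optimality operator. -/
def qRef (M : MDP X A) (πref : Kernel X A) : X × A → ℝ :=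
  Classical.epsilon fun q => BddMeasurable q ∧ M.refBellman πref q = q

/-- The actions at `x` whose value under `q` equals the `πref_x`-essential supremum of
`q(x, ·)`. -/
def optActions (πref : Kernel X A) (q : X × A → ℝ) (x : X) : Set A :=
  {a | q (x, a) = essSup (fun a' => q (x, a')) (πref x)}

/-- A policy is `ε`-reference-optimal if `q^π ≥ q*_ref - ε` everywhere. -/
def IsRefOptimal (M : MDP X A) (πref : Kernel X A) (ε : ℝ) (π : Kernel X A) : Prop :=
  IsMarkovKernel π ∧ ∀ s, M.qRef πref s - ε ≤ M.actionValue π s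

/-- Coverage: uniformly over temperatures and states, the reference policy gives mass at least some
`c > 0` to the actions that maximize the soft optimal action-value function. -/
def Coverage (M : MDP X A) (πref : Kernel X A) : Prop :=
  ∃ c : ℝ, 0 < c ∧ ∀ τ : ℝ, 0 < τ → ∀ x,
    ENNReal.ofReal c ≤ πref x (optActions πref (M.qSoft πref τ) x)

open Classical in
/-- The reference policy filtered by `q`: `πref_x` restricted to `optActions πref q x` and
normalized. -/
def filteredPolicy (πref : Kernel X A) [IsMarkovKernel πref] (q : X × A → ℝ) : Kernel X A :=
  Kernel.withDensity πref fun x a =>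
    if a ∈ optActions πref q x then (πref x (optActions πref q x))⁻¹ else 0

/-- The optimality-filtered reference policy: the reference policy restricted, at each state, to
its reference-optimal actions. -/
def optFilteredPolicy (M : MDP X A) (πref : Kernel X A) [IsMarkovKernel πref] : Kernel X A :=
  filteredPolicy πref (M.qRef πref)

/-- The soft distributional Bellman operator of a policy `π`: the image at `(x, a)` is the law of
`r(x,a) + γ Z - γ τ KL(π_{X'} ‖ πref_{X'})`, where `X' ∼ P_{x,a}`, `A' ∼ π_{X'}` and
`Z ∼ ζ_{X',A'}`. -/
def softEval (M : MDP X A) (πref : Kernel X A) (τ : ℝ) (π : Kernel X A) (ζ : Kernel (X × A) ℝ) :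
    Kernel (X × A) ℝ :=
  (Kernel.id.compProd
      (Kernel.prodMkLeft (X × A)
        ((M.stepKernel π).compProd (Kernel.prodMkLeft (X × A) ζ)))).map
    fun w : (X × A) × ((X × A) × ℝ) =>
      M.r w.1 + M.γ * w.2.2
        - M.γ * τ * (InformationTheory.klDiv (π w.2.1.1) (πref w.2.1.1)).toReal

/-- The soft distributional optimality operator at temperature `τ`. -/
def softControl (M : MDP X A) (πref : Kernel X A) [IsMarkovKernel πref] (τ : ℝ)
    (ζ : Kernel (X × A) ℝ) : Kernel (X × A) ℝ :=
  M.softEval πref τ (boltzmann πref τ (meanFn ζ)) ζ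

/-- `n` steps of soft distributional control at temperature `σ`. -/
def controlIterate (M : MDP X A) (πref : Kernel X A) [IsMarkovKernel πref] (σ : ℝ)
    (ζ₀ : Kernel (X × A) ℝ) (n : ℕ) : Kernel (X × A) ℝ :=
  (M.softControl πref σ)^[n] ζ₀

/-- The decoupled scheme: `nOpt` steps of soft distributional control at temperature `σ`, and then
`nEval` steps, at temperature `τ`, of soft distributional evaluation of the Boltzmann-Gibbs policy
at temperature `τ` of the resulting mean. -/
def decoupledIterate (M : MDP X A) (πref : Kernel X A) [IsMarkovKernel πref] (τ σ : ℝ)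
    (ζ₀ : Kernel (X × A) ℝ) (nOpt nEval : ℕ) : Kernel (X × A) ℝ :=
  (M.softEval πref τ (boltzmann πref τ (meanFn (M.controlIterate πref σ ζ₀ nOpt))))^[nEval]
    (M.controlIterate πref σ ζ₀ nOpt)

end MDP

/-- A temperature decoupling: a positive alternate temperature `σ(τ)` with `σ(τ)/τ → 0` as
`τ → 0⁺`. -/
def IsDecoupling (σ : ℝ → ℝ) : Prop :=
  (∀ τ, 0 < τ → 0 < σ τ) ∧ Tendsto (fun τ => σ τ / τ) (𝓝[>] 0) (𝓝 0)

end

/-! Let `c` be the coverage constant. If the maximizers of `q` have reference mass at least `c`,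
then `essSup q - τ log c⁻¹ ≤ V_τ q ≤ essSup q` at every state. Hence the soft optimal values at
temperature `σ` are `O(σ)`-close to the reference-optimal ones (`abs_qSoft_sub_qRef_le`), and
letting `σ → 0` carries coverage over to `qRef` (`coverage_qRef`). The means of the control iterates
follow the soft Bellman iteration (`controlIterate_spec`), so after enough control steps they are
within `η = C σ_τ` of `qRef`, uniformly.

Optimality: soft evaluation keeps the means within `(τ log c⁻¹ + 2η) / (1 - γ)` of `qRef`, for every
number of steps (`iterate_softEval_spec`), and the Boltzmann-Gibbs policy of any function near
`qRef` is nearly reference-optimal (`isRefOptimal_boltzmann`).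

Return distributions: the evaluated policy dominates `w • πs`, where `πs` is the filtered policy and
`w` is `overlap` (`overlap_smul_le`). Perturbing `q` by `η` costs only a factor `exp (-2η/τ)`, so `w
→ 1` at each state exactly because `σ_τ / τ → 0` (`tendsto_overlap`). Run both return processes with
common transitions and with actions drawn from `w • πs`, killing the lost mass
(`exists_subcoupling`). On the surviving mass the returns differ by a discounted initial discrepancy
and by accumulated KL costs of order `τ + η`; the killed mass is coupled arbitrarily
(`wass_le_of_add_eq`).

The order of choices matters. Survival tends to one only pointwise and for a fixed number of steps,
so `nEval` is fixed first, to make the geometric term small; then `τ`, by dominated convergence over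
`ϖ`; and finally `nOpt`, depending on `τ`. -/

section EssSup

/-! ### Essential suprema of bounded functions -/

variable {Ω : Type*} [MeasurableSpace Ω] {μ : Measure Ω}

theorem ae_le_essSup_of_bound {f : Ω → ℝ} {C : ℝ} (hf : ∀ a, |f a| ≤ C) :
    ∀ᵐ a ∂μ, f a ≤ essSup f μ :=
  ae_le_essSup (isBoundedUnder_of ⟨C, fun a => (abs_le.1 (hf a)).2⟩)

theorem essSup_le_of_bound [NeZero μ] {f : Ω → ℝ} {C : ℝ} (hf : ∀ a, |f a| ≤ C) {c : ℝ}
    (h : ∀ᵐ a ∂μ, f a ≤ c) : essSup f μ ≤ c :=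
  essSup_le_of_ae_le c h
    (isBoundedUnder_of ⟨-C, fun a => (abs_le.1 (hf a)).1⟩ :
      IsBoundedUnder (· ≥ ·) (ae μ) f).isCoboundedUnder_le

theorem essSup_le_iff_of_bound [NeZero μ] {f : Ω → ℝ} {C : ℝ} (hf : ∀ a, |f a| ≤ C) {c : ℝ} :
    essSup f μ ≤ c ↔ ∀ᵐ a ∂μ, f a ≤ c :=
  ⟨fun h => (ae_le_essSup_of_bound hf).mono fun _ ha => ha.trans h, essSup_le_of_bound hf⟩

theorem essSup_le_essSup_add [NeZero μ] {f g : Ω → ℝ} {C D : ℝ} (hf : ∀ a, |f a| ≤ C)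
    (hg : ∀ a, |g a| ≤ D) {c : ℝ} (h : ∀ a, f a ≤ g a + c) :
    essSup f μ ≤ essSup g μ + c := by
  refine essSup_le_of_bound hf ?_
  filter_upwards [ae_le_essSup_of_bound (μ := μ) hg] with a ha
  linarith [h a]

theorem abs_essSup_le [NeZero μ] {f : Ω → ℝ} {C : ℝ} (hf : ∀ a, |f a| ≤ C) :
    |essSup f μ| ≤ C := by
  refine abs_le.2 ⟨?_, essSup_le_of_bound hf (ae_of_all _ fun a => (abs_le.1 (hf a)).2)⟩
  obtain ⟨a, ha⟩ := (ae_le_essSup_of_bound (μ := μ) hf).exists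
  linarith [(abs_le.1 (hf a)).1]

theorem abs_essSup_sub_le [NeZero μ] {f g : Ω → ℝ} {C D : ℝ} (hf : ∀ a, |f a| ≤ C)
    (hg : ∀ a, |g a| ≤ D) {c : ℝ} (h : ∀ a, |f a - g a| ≤ c) :
    |essSup f μ - essSup g μ| ≤ c := by
  have h1 := essSup_le_essSup_add (μ := μ) (c := c) hf hg fun a => by
    linarith [(abs_le.1 (h a)).2]
  have h2 := essSup_le_essSup_add (μ := μ) (c := c) hg hf fun a => by
    linarith [(abs_le.1 (h a)).1]
  exact abs_le.2 ⟨by linarith, by linarith⟩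

end EssSup

/-! ### Fixed points of sup-norm contractions -/

section FixedPoint

variable {Y : Type*} [MeasurableSpace Y]

theorem integrable_of_measurable_of_bound {μ : Measure Y} [IsFiniteMeasure μ] {f : Y → ℝ}
    (hf : Measurable f) {C : ℝ} (hC : ∀ y, |f y| ≤ C) : Integrable f μ :=
  Integrable.of_bound hf.aestronglyMeasurable C (ae_of_all _ hC)

theorem abs_integral_le_of_bound {μ : Measure Y} [IsProbabilityMeasure μ] {f : Y → ℝ} {C : ℝ}
    (hC : ∀ y, |f y| ≤ C) : |∫ y, f y ∂μ| ≤ C := by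
  have h : ∀ᵐ y ∂μ, ‖f y‖ ≤ C := ae_of_all _ hC
  simpa using norm_integral_le_of_norm_le_const h

theorem abs_integral_sub_le {μ : Measure Y} [IsProbabilityMeasure μ] {f g : Y → ℝ} {c : ℝ}
    (hf : Integrable f μ) (hg : Integrable g μ) (h : ∀ y, |f y - g y| ≤ c) :
    |∫ y, f y ∂μ - ∫ y, g y ∂μ| ≤ c := by
  rw [← integral_sub hf hg]
  exact abs_integral_le_of_bound h

/-- A sup-norm contraction of the bounded measurable functions has a fixed point. -/
theorem exists_bddMeasurable_fixedPoint {γ : ℝ} (hγ0 : 0 < γ) (hγ1 : γ < 1)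
    (T : (Y → ℝ) → Y → ℝ) (hT : ∀ q, BddMeasurable q → BddMeasurable (T q))
    (hc : ∀ q q', BddMeasurable q → BddMeasurable q' → ∀ c, (∀ y, |q y - q' y| ≤ c) →
      ∀ y, |T q y - T q' y| ≤ γ * c) :
    ∃ q, BddMeasurable q ∧ T q = q := by
  have h0 : BddMeasurable (0 : Y → ℝ) := ⟨measurable_const, 0, fun _ => by simp⟩
  set u : ℕ → Y → ℝ := fun n => T^[n] 0 with hu
  have hsucc (n) : u (n + 1) = T (u n) := Function.iterate_succ_apply' T n 0
  have hb (n) : BddMeasurable (u n) := by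
    induction n with
    | zero => exact h0
    | succ n ih => rw [hsucc]; exact hT _ ih
  obtain ⟨C, hC⟩ := (hb 1).2
  have hd (n y) : |u n y - u (n + 1) y| ≤ C * γ ^ n := by
    induction n generalizing y with
    | zero => simpa [hu] using hC y
    | succ n ih =>
      rw [hsucc (n + 1)]; nth_rw 1 [hsucc n]
      refine (hc _ _ (hb n) (hb (n + 1)) _ ih y).trans (le_of_eq (by ring))
  have hdist (y n) : dist (u n y) (u (n + 1) y) ≤ C * γ ^ n := hd n y
  have hlim (y) : ∃ l, Tendsto (fun n => u n y) atTop (𝓝 l) :=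
    cauchySeq_tendsto_of_complete (cauchySeq_of_le_geometric γ C hγ1 (hdist y))
  choose q hq using hlim
  -- Convergence is uniform in `y`: this bounds the limit `q`, and the contraction property then
  -- lets `T` pass to the limit.
  have hnear (n y) : |u n y - q y| ≤ C * γ ^ n / (1 - γ) :=
    dist_le_of_le_geometric_of_tendsto γ C hγ1 (hdist y) (hq y) n
  have hqb : BddMeasurable q := by
    refine ⟨measurable_of_tendsto_metrizable (fun n => (hb n).1) (tendsto_pi_nhds.2 hq),
      C * γ ^ 0 / (1 - γ), fun y => ?_⟩
    simpa [hu] using hnear 0 y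
  refine ⟨q, hqb, funext fun y => ?_⟩
  refine tendsto_nhds_unique (f := fun n => u (n + 1) y) ?_ ((tendsto_add_atTop_iff_nat 1).2 (hq y))
  rw [tendsto_iff_dist_tendsto_zero]
  have hz : Tendsto (fun n : ℕ => γ * (C * γ ^ n / (1 - γ))) atTop (𝓝 0) := by
    have := ((tendsto_pow_atTop_nhds_zero_of_lt_one hγ0.le hγ1).const_mul C).div_const (1 - γ)
    simpa using this.const_mul γ
  refine squeeze_zero (fun _ => dist_nonneg) (fun n => ?_) hz
  rw [hsucc]
  exact hc _ _ (hb n) hqb _ (hnear n) y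

/-- A bounded function whose upper bounds `c` self-improve to `γ * (β + c)` is at most
`γ * β / (1 - γ)`. -/
theorem le_of_self_improving {Y : Type*} {γ β C : ℝ} (hγ1 : γ < 1) {f : Y → ℝ}
    (hf : ∀ y, f y ≤ C)
    (h : ∀ c, (∀ y, f y ≤ c) → ∀ y, f y ≤ γ * (β + c)) (y : Y) : f y ≤ γ * β / (1 - γ) := by
  have : Nonempty Y := ⟨y⟩
  have hbdd : BddAbove (Set.range f) := ⟨C, by rintro _ ⟨y, rfl⟩; exact hf y⟩
  -- The supremum is itself an admissible upper bound, so the self-improvement applies to it.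
  have hs : (⨆ y, f y) ≤ γ * (β + ⨆ y, f y) := ciSup_le (h _ (le_ciSup hbdd))
  refine (le_ciSup hbdd y).trans ?_
  rw [le_div_iff₀ (by linarith)]
  linarith

end FixedPoint

namespace MDP

variable {X A : Type*} [MeasurableSpace X] [MeasurableSpace A]

/-! ### Soft values compared with essential suprema -/

section Values

variable (πref : Kernel X A) [IsMarkovKernel πref] {q q' : X × A → ℝ}

/-- The sublevel set at `t` consists of the states where `{q > t}` is null, and the measure of a
section is measurable in the state. -/
theorem measurable_essSup_kernel (hq : BddMeasurable q) :
    Measurable fun x => essSup (fun a => q (x, a)) (πref x) := by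
  obtain ⟨hm, C, hC⟩ := hq
  refine measurable_of_Iic fun t => ?_
  have : (fun x => essSup (fun a => q (x, a)) (πref x)) ⁻¹' Set.Iic t
      = {x | πref x (Prod.mk x ⁻¹' {s | ¬ q s ≤ t}) = 0} := by
    ext x
    exact essSup_le_iff_of_bound fun a => hC (x, a)
  rw [this]
  exact (Kernel.measurable_kernel_prodMk_left (measurableSet_le hm measurable_const).compl)
    (measurableSet_singleton 0)

theorem integrable_exp_div (hq : BddMeasurable q) (τ : ℝ) (x : X) (μ : Measure A)
    [IsFiniteMeasure μ] : Integrable (fun a => Real.exp (q (x, a) / τ)) μ := by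
  obtain ⟨hm, C, hC⟩ := hq
  refine integrable_of_measurable_of_bound (C := Real.exp (C / |τ|)) (by fun_prop) fun a => ?_
  rw [abs_of_pos (Real.exp_pos _), Real.exp_le_exp]
  refine (le_abs_self _).trans ?_
  rw [abs_div]
  exact div_le_div_of_nonneg_right (hC _) (abs_nonneg _)

theorem integral_exp_div_pos (hq : BddMeasurable q) (τ : ℝ) (x : X) :
    0 < ∫ a, Real.exp (q (x, a) / τ) ∂(πref x) :=
  MeasureTheory.integral_exp_pos (integrable_exp_div hq τ x _)

theorem measurable_softValue (hq : BddMeasurable q) (τ : ℝ) :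
    Measurable (softValue πref τ q) := by
  have hm := hq.1
  refine (Real.measurable_log.comp ?_).const_mul τ
  exact (StronglyMeasurable.integral_kernel_prod_right'
    (f := fun s : X × A => Real.exp (q s / τ)) (by fun_prop)).measurable

theorem softValue_le_of_ae_le (hq : BddMeasurable q) {τ : ℝ} (hτ : 0 < τ) {x : X} {c : ℝ}
    (h : ∀ᵐ a ∂πref x, q (x, a) ≤ c) : softValue πref τ q x ≤ c := by
  have : ∫ a, Real.exp (q (x, a) / τ) ∂(πref x) ≤ Real.exp (c / τ) := by
    have h' : ∀ᵐ a ∂πref x, Real.exp (q (x, a) / τ) ≤ Real.exp (c / τ) := by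
      filter_upwards [h] with a ha
      gcongr
    simpa using integral_mono_ae (integrable_exp_div hq τ x _) (integrable_const _) h'
  have := Real.log_le_log (integral_exp_div_pos πref hq τ x) this
  rw [Real.log_exp, le_div_iff₀ hτ] at this
  unfold softValue
  linarith

theorem softValue_le_add (hq : BddMeasurable q) (hq' : BddMeasurable q') {τ : ℝ} (hτ : 0 < τ)
    {x : X} {c : ℝ} (h : ∀ a, q (x, a) ≤ q' (x, a) + c) :
    softValue πref τ q x ≤ softValue πref τ q' x + c := by
  have : ∫ a, Real.exp (q (x, a) / τ) ∂(πref x)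
      ≤ Real.exp (c / τ) * ∫ a, Real.exp (q' (x, a) / τ) ∂(πref x) := by
    rw [← integral_const_mul]
    refine integral_mono (integrable_exp_div hq τ x _)
      ((integrable_exp_div hq' τ x _).const_mul _) fun a => ?_
    simp only
    rw [← Real.exp_add, Real.exp_le_exp, ← add_div]
    gcongr
    linarith [h a]
  have := Real.log_le_log (integral_exp_div_pos πref hq τ x) this
  rw [Real.log_mul (Real.exp_ne_zero _) (integral_exp_div_pos πref hq' τ x).ne', Real.log_exp] at this
  have h2 := mul_le_mul_of_nonneg_left this hτ.le
  rw [mul_add, mul_div_cancel₀ _ hτ.ne'] at h2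
  unfold softValue
  linarith

theorem abs_softValue_sub_le (hq : BddMeasurable q) (hq' : BddMeasurable q') {τ : ℝ}
    (hτ : 0 < τ) {x : X} {c : ℝ} (h : ∀ a, |q (x, a) - q' (x, a)| ≤ c) :
    |softValue πref τ q x - softValue πref τ q' x| ≤ c := by
  have h1 := softValue_le_add πref hq hq' hτ (c := c) fun a => by
    linarith [(abs_le.1 (h a)).2]
  have h2 := softValue_le_add πref hq' hq hτ (c := c) fun a => by
    linarith [(abs_le.1 (h a)).1]
  exact abs_le.2 ⟨by linarith, by linarith⟩

theorem abs_softValue_le (hq : BddMeasurable q) {τ : ℝ} (hτ : 0 < τ) {x : X} {c : ℝ}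
    (h : ∀ a, |q (x, a)| ≤ c) : |softValue πref τ q x| ≤ c := by
  have h0 : BddMeasurable (0 : X × A → ℝ) := ⟨measurable_const, 0, fun _ => by simp⟩
  have := abs_softValue_sub_le πref hq h0 hτ (c := c) (x := x) (by simpa using h)
  simpa [softValue] using this

theorem softValue_le_essSup (hq : BddMeasurable q) {τ : ℝ} (hτ : 0 < τ) (x : X) :
    softValue πref τ q x ≤ essSup (fun a => q (x, a)) (πref x) := by
  obtain ⟨C, hC⟩ := hq.2
  exact softValue_le_of_ae_le πref hq hτ (ae_le_essSup_of_bound fun a => hC (x, a))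

theorem measurableSet_optActions_prod (hq : BddMeasurable q) :
    MeasurableSet {s : X × A | s.2 ∈ optActions πref q s.1} :=
  measurableSet_eq_fun hq.1 ((measurable_essSup_kernel πref hq).comp measurable_fst)

theorem measurableSet_optActions (hq : BddMeasurable q) (x : X) :
    MeasurableSet (optActions πref q x) :=
  measurable_prodMk_left (measurableSet_optActions_prod πref hq)

/-- On the maximizers the integrand is the constant `exp (m / τ)`, so the partition function is at
least `c * exp (m / τ)`. The loss `τ log c⁻¹` is uniform in the state. -/
theorem essSup_sub_le_softValue (hq : BddMeasurable q) {τ : ℝ} (hτ : 0 < τ) {x : X} {c : ℝ}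
    (hc : 0 < c) (h : ENNReal.ofReal c ≤ πref x (optActions πref q x)) :
    essSup (fun a => q (x, a)) (πref x) - τ * Real.log c⁻¹ ≤ softValue πref τ q x := by
  set m := essSup (fun a => q (x, a)) (πref x)
  have hS := measurableSet_optActions πref hq x
  have h1 : c * Real.exp (m / τ) ≤ ∫ a, Real.exp (q (x, a) / τ) ∂(πref x) := by
    calc c * Real.exp (m / τ)
        ≤ (πref x).real (optActions πref q x) * Real.exp (m / τ) := by
          gcongr
          exact (ENNReal.ofReal_le_iff_le_toReal (measure_ne_top _ _)).1 h
      _ = ∫ a in optActions πref q x, Real.exp (m / τ) ∂(πref x) := by simp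
      _ = ∫ a in optActions πref q x, Real.exp (q (x, a) / τ) ∂(πref x) := by
          refine setIntegral_congr_fun hS fun a ha => ?_
          have : q (x, a) = m := ha
          simp [this]
      _ ≤ _ := setIntegral_le_integral (integrable_exp_div hq τ x _)
          (ae_of_all _ fun a => (Real.exp_pos _).le)
  have h2 := Real.log_le_log (by positivity) h1
  rw [Real.log_mul hc.ne' (Real.exp_ne_zero _), Real.log_exp] at h2
  have h3 := mul_le_mul_of_nonneg_left h2 hτ.le
  rw [mul_add, mul_div_cancel₀ _ hτ.ne'] at h3
  rw [Real.log_inv]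
  unfold softValue
  linarith

end Values

/-! ### The soft and reference Bellman operators and their fixed points -/

section FixedPoints

variable (M : MDP X A) (πref : Kernel X A) [IsMarkovKernel πref]

/-- Both Bellman operators have the form `r + γ P v`, with `v` a soft value or an essential
supremum; this lemma and the next treat them together. -/
theorem bddMeasurable_bellman {v : X → ℝ} (hv : Measurable v) {C : ℝ} (hC : ∀ x, |v x| ≤ C) :
    BddMeasurable fun s => M.r s + M.γ * ∫ x, v x ∂(M.P s) := by
  have := M.markov_P
  obtain ⟨hr, R, hR⟩ := M.bddMeasurable_r
  refine ⟨hr.add ((hv.stronglyMeasurable.integral_kernel (κ := M.P)).measurable.const_mul _),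
    R + M.γ * C, fun s => ?_⟩
  refine (abs_add_le _ _).trans (add_le_add (hR s) ?_)
  rw [abs_mul, abs_of_pos M.γ_pos]
  exact mul_le_mul_of_nonneg_left (abs_integral_le_of_bound hC) M.γ_pos.le

theorem abs_bellman_sub_le {v v' : X → ℝ} (hv : Measurable v) (hv' : Measurable v') {C C' : ℝ}
    (hC : ∀ x, |v x| ≤ C) (hC' : ∀ x, |v' x| ≤ C') {c : ℝ} (h : ∀ x, |v x - v' x| ≤ c)
    (s : X × A) :
    |(M.r s + M.γ * ∫ x, v x ∂(M.P s)) - (M.r s + M.γ * ∫ x, v' x ∂(M.P s))| ≤ M.γ * c := by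
  have := M.markov_P
  rw [add_sub_add_left_eq_sub, ← mul_sub, abs_mul, abs_of_pos M.γ_pos]
  exact mul_le_mul_of_nonneg_left (abs_integral_sub_le (integrable_of_measurable_of_bound hv hC)
    (integrable_of_measurable_of_bound hv' hC') h) M.γ_pos.le

theorem bddMeasurable_softBellman {τ : ℝ} (hτ : 0 < τ) {q : X × A → ℝ} (hq : BddMeasurable q) :
    BddMeasurable (M.softBellman πref τ q) := by
  obtain ⟨C, hC⟩ := hq.2
  exact M.bddMeasurable_bellman (measurable_softValue πref hq τ)
    fun x => abs_softValue_le πref hq hτ fun a => hC (x, a)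

theorem abs_softBellman_sub_le {τ : ℝ} (hτ : 0 < τ) {q q' : X × A → ℝ} (hq : BddMeasurable q)
    (hq' : BddMeasurable q') {c : ℝ} (h : ∀ s, |q s - q' s| ≤ c) (s : X × A) :
    |M.softBellman πref τ q s - M.softBellman πref τ q' s| ≤ M.γ * c := by
  obtain ⟨C, hC⟩ := hq.2
  obtain ⟨C', hC'⟩ := hq'.2
  exact M.abs_bellman_sub_le (measurable_softValue πref hq τ) (measurable_softValue πref hq' τ)
    (fun x => abs_softValue_le πref hq hτ fun a => hC (x, a))
    (fun x => abs_softValue_le πref hq' hτ fun a => hC' (x, a))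
    (fun x => abs_softValue_sub_le πref hq hq' hτ fun a => h (x, a)) s

theorem qSoft_spec {τ : ℝ} (hτ : 0 < τ) :
    BddMeasurable (M.qSoft πref τ) ∧ M.softBellman πref τ (M.qSoft πref τ) = M.qSoft πref τ :=
  Classical.epsilon_spec (p := fun q => BddMeasurable q ∧ M.softBellman πref τ q = q)
    (exists_bddMeasurable_fixedPoint M.γ_pos M.γ_lt_one _
      (fun _ => M.bddMeasurable_softBellman πref hτ)
      fun _ _ hq hq' _ => M.abs_softBellman_sub_le πref hτ hq hq')

theorem qRef_spec :
    BddMeasurable (M.qRef πref) ∧ M.refBellman πref (M.qRef πref) = M.qRef πref := by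
  refine Classical.epsilon_spec (p := fun q => BddMeasurable q ∧ M.refBellman πref q = q)
    (exists_bddMeasurable_fixedPoint M.γ_pos M.γ_lt_one _ ?_ ?_)
  · intro q hq
    obtain ⟨C, hC⟩ := hq.2
    exact M.bddMeasurable_bellman (measurable_essSup_kernel πref hq)
      fun x => abs_essSup_le fun a => hC (x, a)
  · intro q q' hq hq' c h s
    obtain ⟨C, hC⟩ := hq.2
    obtain ⟨C', hC'⟩ := hq'.2
    exact M.abs_bellman_sub_le (measurable_essSup_kernel πref hq)
      (measurable_essSup_kernel πref hq') (fun x => abs_essSup_le fun a => hC (x, a))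
      (fun x => abs_essSup_le fun a => hC' (x, a))
      (fun x => abs_essSup_sub_le (fun a => hC (x, a)) (fun a => hC' (x, a))
        fun a => h (x, a)) s

variable {M πref} {c : ℝ}

/-- The soft optimal values are within `γ σ log c⁻¹ / (1 - γ)` of the reference-optimal ones. -/
theorem abs_qSoft_sub_qRef_le (hc : 0 < c) {σ : ℝ} (hσ : 0 < σ)
    (hcov : ∀ x, ENNReal.ofReal c ≤ πref x (optActions πref (M.qSoft πref σ) x)) (s : X × A) :
    |M.qSoft πref σ s - M.qRef πref s| ≤ M.γ * (σ * Real.log c⁻¹) / (1 - M.γ) := by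
  obtain ⟨hq, hqf⟩ := M.qSoft_spec πref hσ
  obtain ⟨hr, hrf⟩ := M.qRef_spec πref
  obtain ⟨C, hC⟩ := hq.2
  obtain ⟨D, hD⟩ := hr.2
  refine le_of_self_improving (f := fun s => |M.qSoft πref σ s - M.qRef πref s|) (C := C + D)
    M.γ_lt_one (fun s => (abs_sub _ _).trans (add_le_add (hC s) (hD s))) ?_ s
  intro e he s
  nth_rw 1 [← hqf, ← hrf]
  refine M.abs_bellman_sub_le (measurable_softValue πref hq σ) (measurable_essSup_kernel πref hr)
    (fun x => abs_softValue_le πref hq hσ fun a => hC (x, a))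
    (fun x => abs_essSup_le fun a => hD (x, a)) (fun x => ?_) s
  have h1 := abs_le.1 (abs_essSup_sub_le (μ := πref x) (fun a => hC (x, a)) (fun a => hD (x, a))
        fun a => he (x, a))
  have h2 := softValue_le_essSup πref hq hσ x
  have h3 := essSup_sub_le_softValue πref hq hσ hc (hcov x)
  exact abs_le.2 ⟨by linarith [h1.1], by
    -- The bounds `h2` and `h3` sandwich the soft value, which forces this sign without `c ≤ 1`.
    have : 0 ≤ σ * Real.log c⁻¹ := by linarith
    linarith [h1.2]⟩

end FixedPoints

end MDP

namespace MDP

variable {X A : Type*} [MeasurableSpace X] [MeasurableSpace A]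

/-! ### Coverage in the zero-temperature limit -/

section Coverage

variable {M : MDP X A} {πref : Kernel X A} [IsMarkovKernel πref] {c : ℝ}

/-- Coverage for the soft optimal values passes to the reference-optimal values. -/
theorem coverage_qRef (hc : 0 < c)
    (hcov : ∀ τ : ℝ, 0 < τ → ∀ x, ENNReal.ofReal c ≤ πref x (optActions πref (M.qSoft πref τ) x))
    (x : X) : ENNReal.ofReal c ≤ πref x (optActions πref (M.qRef πref) x) := by
  obtain ⟨hr, -⟩ := M.qRef_spec πref
  obtain ⟨D, hD⟩ := hr.2
  have hγ := M.γ_lt_one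
  set m := essSup (fun a => M.qRef πref (x, a)) (πref x)
  have hmeas : Measurable fun a => M.qRef πref (x, a) := hr.1.comp measurable_prodMk_left
  -- At a temperature whose bias is at most `e / 2`, a soft maximizer loses at most `e / 2` in its
  -- value and `e / 2` in the essential supremum.
  have key (e : ℝ) (he : 0 < e) : ENNReal.ofReal c ≤ πref x {a | m - e ≤ M.qRef πref (x, a)} := by
    obtain ⟨σ, hσ, hσe⟩ : ∃ σ : ℝ, 0 < σ ∧
        M.γ * (σ * Real.log c⁻¹) / (1 - M.γ) ≤ e / 2 := by
      have ht : Tendsto (fun σ : ℝ => M.γ * (σ * Real.log c⁻¹) / (1 - M.γ)) (𝓝[>] 0) (𝓝 0) := by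
        refine Tendsto.mono_left ?_ nhdsWithin_le_nhds
        refine Continuous.tendsto' (by fun_prop) _ _ (by simp)
      obtain ⟨σ, h1, h2⟩ := ((ht.eventually (ge_mem_nhds (half_pos he))).and
        self_mem_nhdsWithin).exists
      exact ⟨σ, h2, h1⟩
    refine (hcov σ hσ x).trans (measure_mono fun a ha => ?_)
    obtain ⟨hq, -⟩ := M.qSoft_spec πref hσ
    obtain ⟨C, hC⟩ := hq.2
    have hd (s) := (abs_qSoft_sub_qRef_le hc hσ (hcov σ hσ) s).trans hσe
    have h1 := abs_le.1 (abs_essSup_sub_le (μ := πref x) (fun a => hC (x, a)) (fun a => hD (x, a))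
      fun a => hd (x, a))
    have h2 := abs_le.1 (hd (x, a))
    have h3 : M.qSoft πref σ (x, a) = essSup (fun a => M.qSoft πref σ (x, a)) (πref x) := ha
    show m - e ≤ _
    linarith [h1.1, h2.2]
  have hanti : Antitone fun n : ℕ => {a | m - 1 / ((n : ℝ) + 1) ≤ M.qRef πref (x, a)} := by
    intro i j hij a ha
    have : 1 / ((j : ℝ) + 1) ≤ 1 / ((i : ℝ) + 1) := by gcongr
    simp only [Set.mem_ofPred_eq] at ha ⊢
    linarith
  have hlim := tendsto_measure_iInter_atTop (μ := πref x)
    (fun n => (measurableSet_le measurable_const hmeas).nullMeasurableSet) hanti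
    ⟨0, measure_ne_top _ _⟩
  -- Continuity from above: the near-optimal sets decrease to `{m ≤ qRef}`, which is almost
  -- everywhere contained in the set of maximizers.
  have hge := ge_of_tendsto' hlim fun n => key _ (by positivity)
  refine hge.trans (measure_mono_ae ?_)
  filter_upwards [ae_le_essSup_of_bound (μ := πref x) fun a => hD (x, a)] with a ha h
  refine le_antisymm ha (le_of_tendsto' (x := atTop)
    (f := fun n : ℕ => m - 1 / ((n : ℝ) + 1)) ?_ fun n => Set.mem_iInter.1 h n)
  simpa using tendsto_one_div_add_atTop_nhds_zero_nat.const_sub m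

end Coverage

/-! ### Boltzmann-Gibbs policies and their relative entropy -/

section Boltzmann

variable (πref : Kernel X A) [IsMarkovKernel πref] {q : X × A → ℝ} {τ : ℝ}

theorem boltzmann_apply (hq : BddMeasurable q) (x : X) :
    boltzmann πref τ q x = (πref x).withDensity fun a =>
      ENNReal.ofReal (Real.exp ((q (x, a) - softValue πref τ q x) / τ)) := by
  refine Kernel.withDensity_apply _ ?_ _
  have h1 := hq.1
  have h2 := measurable_softValue πref hq τ
  simp only [Function.uncurry_def, Prod.mk.eta]
  fun_prop

/-- As an exponential tilt the policy inherits its normalization, absolute continuity and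
log-density. -/
theorem boltzmann_apply_eq_tilted (hq : BddMeasurable q) (hτ : 0 < τ) (x : X) :
    boltzmann πref τ q x = (πref x).tilted fun a => q (x, a) / τ := by
  rw [boltzmann_apply πref hq, Measure.tilted]
  congr with a
  congr
  rw [sub_div, Real.exp_sub]
  congr
  rw [softValue, mul_div_cancel_left₀ _ hτ.ne', Real.exp_log (integral_exp_div_pos πref hq τ x)]

theorem isMarkovKernel_boltzmann (hq : BddMeasurable q) (hτ : 0 < τ) :
    IsMarkovKernel (boltzmann πref τ q) := by
  refine ⟨fun x => ?_⟩
  rw [boltzmann_apply_eq_tilted πref hq hτ]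
  exact isProbabilityMeasure_tilted (integrable_exp_div hq τ x _)

/-- The variational identity `τ KL(BG_τ q ‖ πref) = ∫ q d(BG_τ q) - V_τ q`. -/
theorem mul_klDiv_boltzmann (hq : BddMeasurable q) (hτ : 0 < τ) (x : X) :
    τ * (InformationTheory.klDiv (boltzmann πref τ q x) (πref x)).toReal
      = ∫ a, q (x, a) ∂(boltzmann πref τ q x) - softValue πref τ q x := by
  obtain ⟨hm, C, hC⟩ := id hq
  have hint := integrable_exp_div hq τ x (πref x)
  have := isMarkovKernel_boltzmann πref hq hτ
  have hac : boltzmann πref τ q x ≪ πref x := by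
    rw [boltzmann_apply_eq_tilted πref hq hτ]; exact tilted_absolutelyContinuous _ _
  have hqi : Integrable (fun a => q (x, a)) (boltzmann πref τ q x) :=
    integrable_of_measurable_of_bound (hm.comp measurable_prodMk_left) fun a => hC (x, a)
  have hllr : llr (boltzmann πref τ q x) (πref x) =ᵐ[boltzmann πref τ q x]
      fun a => q (x, a) / τ - Real.log (∫ a, Real.exp (q (x, a) / τ) ∂(πref x)) := by
    refine hac.ae_le ?_
    rw [boltzmann_apply_eq_tilted πref hq hτ]
    exact log_rnDeriv_tilted_left_self hint
  rw [InformationTheory.toReal_klDiv_of_measure_eq hac (by simp), integral_congr_ae hllr,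
    integral_sub (hqi.div_const τ) (integrable_const _), integral_div, mul_sub,
    mul_div_cancel₀ _ hτ.ne']
  simp [softValue]

theorem softValue_le_integral_boltzmann (hq : BddMeasurable q) (hτ : 0 < τ) (x : X) :
    softValue πref τ q x ≤ ∫ a, q (x, a) ∂(boltzmann πref τ q x) := by
  have := mul_klDiv_boltzmann πref hq hτ x
  have : 0 ≤ τ * (InformationTheory.klDiv (boltzmann πref τ q x) (πref x)).toReal := by positivity
  linarith

theorem measurable_integral_kernel {π : Kernel X A} [IsMarkovKernel π] (hq : Measurable q) :
    Measurable fun x => ∫ a, q (x, a) ∂(π x) :=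
  hq.stronglyMeasurable.integral_kernel_prod_right'.measurable

/-- The variational identity writes the divergence through measurable functions of the state.
Without measurability `Kernel.map` in `softEval` would take its junk value. -/
theorem measurable_klDiv_boltzmann (hq : BddMeasurable q) (hτ : 0 < τ) :
    Measurable fun x => (InformationTheory.klDiv (boltzmann πref τ q x) (πref x)).toReal := by
  have := isMarkovKernel_boltzmann πref hq hτ
  have h : (fun x => (InformationTheory.klDiv (boltzmann πref τ q x) (πref x)).toReal)
      = fun x => (∫ a, q (x, a) ∂(boltzmann πref τ q x) - softValue πref τ q x) / τ := by
    funext x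
    rw [← mul_klDiv_boltzmann πref hq hτ, mul_div_cancel_left₀ _ hτ.ne']
  rw [h]
  exact ((measurable_integral_kernel hq.1).sub (measurable_softValue πref hq τ)).div_const τ

theorem mul_klDiv_boltzmann_le (hq : BddMeasurable q) (hτ : 0 < τ) {C : ℝ} (hC : ∀ s, |q s| ≤ C)
    (x : X) : τ * (InformationTheory.klDiv (boltzmann πref τ q x) (πref x)).toReal ≤ 2 * C := by
  have := isMarkovKernel_boltzmann πref hq hτ
  rw [mul_klDiv_boltzmann πref hq hτ]
  have h1 := abs_softValue_le πref hq hτ (x := x) fun a => hC (x, a)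
  have h2 := abs_integral_le_of_bound (μ := boltzmann πref τ q x) fun a => hC (x, a)
  linarith [(abs_le.1 h1).1, (abs_le.1 h2).2]

end Boltzmann

/-! ### One step of soft distributional evaluation -/

section SoftEval

variable (M : MDP X A) {πref π : Kernel X A} [IsMarkovKernel π] {τ : ℝ} {ζ : Kernel (X × A) ℝ}

/-- The per-step regularization cost `τ KL(π_x ‖ πref_x)`. -/
noncomputable def klCost (πref : Kernel X A) (τ : ℝ) (π : Kernel X A) (x : X) : ℝ :=
  τ * (InformationTheory.klDiv (π x) (πref x)).toReal

theorem lintegral_stepKernel (π : Kernel X A) [IsSFiniteKernel π] {f : X × A → ℝ≥0∞}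
    (hf : Measurable f) (s : X × A) :
    ∫⁻ s', f s' ∂(M.stepKernel π s) = ∫⁻ x, ∫⁻ a, f (x, a) ∂(π x) ∂(M.P s) := by
  have := M.markov_P
  simp [stepKernel, Kernel.lintegral_compProd _ _ _ hf]

theorem softEval_apply [IsMarkovKernel ζ] (hk : Measurable (klCost πref τ π)) (s : X × A) :
    M.softEval πref τ π ζ s =
      ((M.stepKernel π).compProd (Kernel.prodMkLeft (X × A) ζ) s).map
        fun w => M.r s + M.γ * w.2 - M.γ * klCost πref τ π w.1.1 := by
  have := M.isMarkovKernel_stepKernel π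
  have hr := M.bddMeasurable_r.1
  have hF : Measurable fun w : (X × A) × ((X × A) × ℝ) =>
      M.r w.1 + M.γ * w.2.2 - M.γ * klCost πref τ π w.2.1.1 := by fun_prop
  have hF' : (fun w : (X × A) × ((X × A) × ℝ) => M.r w.1 + M.γ * w.2.2
        - M.γ * τ * (InformationTheory.klDiv (π w.2.1.1) (πref w.2.1.1)).toReal)
      = fun w => M.r w.1 + M.γ * w.2.2 - M.γ * klCost πref τ π w.2.1.1 := by
    funext w; simp [klCost, mul_assoc]
  rw [softEval, hF', Kernel.map_apply _ hF]
  ext t ht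
  rw [Measure.map_apply hF ht, Measure.map_apply (by fun_prop) ht,
    Kernel.compProd_apply (hF ht), Kernel.lintegral_id']
  · rfl
  · exact Kernel.measurable_kernel_prodMk_left
      (κ := (M.stepKernel π).compProd (Kernel.prodMkLeft (X × A) ζ)) (hF ht)

theorem isMarkovKernel_softEval [IsMarkovKernel ζ] (hk : Measurable (klCost πref τ π)) :
    IsMarkovKernel (M.softEval πref τ π ζ) := by
  have := M.isMarkovKernel_stepKernel π
  have hr := M.bddMeasurable_r.1
  refine ⟨fun s => ?_⟩
  rw [M.softEval_apply hk]
  exact Measure.isProbabilityMeasure_map (by fun_prop)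

theorem lintegral_softEval [IsMarkovKernel ζ] (hk : Measurable (klCost πref τ π))
    {f : ℝ → ℝ≥0∞} (hf : Measurable f) (s : X × A) :
    ∫⁻ z, f z ∂(M.softEval πref τ π ζ s) = ∫⁻ s', ∫⁻ z,
      f (M.r s + M.γ * z - M.γ * klCost πref τ π s'.1) ∂(ζ s') ∂(M.stepKernel π s) := by
  have := M.isMarkovKernel_stepKernel π
  rw [M.softEval_apply hk, lintegral_map hf (by fun_prop),
    Kernel.lintegral_compProd _ _ _ (by fun_prop)]
  rfl

theorem integral_stepKernel {f : X × A → ℝ} (hf : BddMeasurable f) (s : X × A) :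
    ∫ s', f s' ∂(M.stepKernel π s) = ∫ x, ∫ a, f (x, a) ∂(π x) ∂(M.P s) := by
  have := M.markov_P
  have := M.isMarkovKernel_stepKernel π
  obtain ⟨hm, C, hC⟩ := hf
  exact ProbabilityTheory.integral_compProd
    (integrable_of_measurable_of_bound (μ := M.stepKernel π s) hm hC)

theorem bddMeasurable_meanFn [IsMarkovKernel ζ] {C : ℝ}
    (hζ : ∀ s, ∫⁻ z, ‖z‖ₑ ∂(ζ s) ≤ ENNReal.ofReal C) :
    BddMeasurable (meanFn ζ) := by
  refine ⟨(stronglyMeasurable_id.integral_kernel (κ := ζ)).measurable, |C|, fun s => ?_⟩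
  have h1 := (enorm_integral_le_lintegral_enorm (μ := ζ s) fun z => z).trans (hζ s)
  rw [Real.enorm_eq_ofReal_abs] at h1
  exact (ENNReal.ofReal_le_ofReal_iff (abs_nonneg _)).1
    (h1.trans (ENNReal.ofReal_le_ofReal (le_abs_self C)))

/-- The general cost `k` serves twice: `k = klCost` gives the mean of `softEval`, and `k = 0` the
Bellman equation of a policy. -/
theorem integral_affine_return [IsMarkovKernel ζ] {C : ℝ}
    (hζ : ∀ s, ∫⁻ z, ‖z‖ₑ ∂(ζ s) ≤ ENNReal.ofReal C) {k : X → ℝ} (hk : Measurable k) {D : ℝ}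
    (hD : ∀ x, |k x| ≤ D) (s : X × A) :
    ∫ w, (M.r s + M.γ * w.2 - M.γ * k w.1.1)
        ∂((M.stepKernel π).compProd (Kernel.prodMkLeft (X × A) ζ) s)
      = M.r s + M.γ * ∫ x, (∫ a, meanFn ζ (x, a) ∂(π x) - k x) ∂(M.P s) := by
  have := M.markov_P
  have := M.isMarkovKernel_stepKernel π
  have hmean := bddMeasurable_meanFn hζ
  have h2 : Integrable (fun w : (X × A) × ℝ => w.2)
      ((M.stepKernel π).compProd (Kernel.prodMkLeft (X × A) ζ) s) := by
    refine ⟨measurable_snd.aestronglyMeasurable, ?_⟩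
    rw [HasFiniteIntegral, Kernel.lintegral_compProd _ _ _ (by fun_prop)]
    calc _ ≤ ∫⁻ s', ENNReal.ofReal C ∂(M.stepKernel π s) := lintegral_mono fun s' => hζ s'
      _ < ⊤ := by simp
  have h1 : Integrable (fun w : (X × A) × ℝ => k w.1.1)
      ((M.stepKernel π).compProd (Kernel.prodMkLeft (X × A) ζ) s) :=
    integrable_of_measurable_of_bound (by fun_prop) fun w => hD w.1.1
  obtain ⟨hmm, E, hE⟩ := hmean
  have h3 : Integrable (fun w : (X × A) × ℝ => M.r s + M.γ * w.2)
      ((M.stepKernel π).compProd (Kernel.prodMkLeft (X × A) ζ) s) :=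
    (integrable_const _).add (h2.const_mul _)
  rw [integral_sub h3 (h1.const_mul _), integral_add (integrable_const _) (h2.const_mul _), integral_const_mul, integral_const_mul,
    ProbabilityTheory.integral_compProd h2, ProbabilityTheory.integral_compProd h1]
  simp only [Kernel.prodMkLeft_apply, integral_const, probReal_univ, one_smul]
  rw [M.integral_stepKernel (f := fun s => k s.1) ⟨hk.comp measurable_fst, D, fun s => hD s.1⟩]
  have := M.integral_stepKernel (π := π) ⟨hmm, E, hE⟩ s
  simp only [meanFn] at this
  rw [this, integral_sub]
  · simp [meanFn]; ring
  · exact integrable_of_measurable_of_bound (measurable_integral_kernel hmm)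
      fun x => abs_integral_le_of_bound fun a => hE (x, a)
  · exact integrable_of_measurable_of_bound hk hD

theorem meanFn_softEval [IsMarkovKernel ζ] {C : ℝ}
    (hζ : ∀ s, ∫⁻ z, ‖z‖ₑ ∂(ζ s) ≤ ENNReal.ofReal C) (hk : Measurable (klCost πref τ π)) {D : ℝ}
    (hD : ∀ x, |klCost πref τ π x| ≤ D) (s : X × A) :
    meanFn (M.softEval πref τ π ζ) s
      = M.r s + M.γ * ∫ x, (∫ a, meanFn ζ (x, a) ∂(π x) - klCost πref τ π x) ∂(M.P s) := by
  rw [meanFn, M.softEval_apply hk, integral_map (by fun_prop) (by fun_prop)]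
  exact M.integral_affine_return hζ hk hD s

end SoftEval

end MDP

/-! ### First-step analysis of a homogeneous Markov chain -/

section MarkovChain

variable {S : Type*} [MeasurableSpace S]

/-- The kernels on histories of a homogeneous Markov chain with transition kernel `k`. -/
noncomputable def markovHistory (k : Kernel S S) (n : ℕ) :
    Kernel ((_ : Finset.Iic n) → S) S :=
  k.comap (fun h => h ⟨n, Finset.mem_Iic.2 le_rfl⟩) (measurable_pi_apply _)

instance (k : Kernel S S) [IsMarkovKernel k] (n : ℕ) : IsMarkovKernel (markovHistory k n) := by
  unfold markovHistory; infer_instance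

/-- Forget the first entry of a history. -/
def shiftHistory (n : ℕ) (h : (_ : Finset.Iic (n + 1)) → S) : (_ : Finset.Iic n) → S :=
  fun i => h ⟨i.1 + 1, Finset.mem_Iic.2 (Nat.succ_le_succ (Finset.mem_Iic.1 i.2))⟩

theorem measurable_shiftHistory (n : ℕ) : Measurable (shiftHistory (S := S) n) :=
  measurable_pi_lambda _ fun _ => measurable_pi_apply _

/-- Append an entry to a history. -/
def snocHistory (n : ℕ) (y : (_ : Finset.Iic n) → S) (z : S) : (_ : Finset.Iic (n + 1)) → S :=
  fun i => if h : i.1 ≤ n then y ⟨i.1, Finset.mem_Iic.2 h⟩ else z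

theorem shiftHistory_snocHistory {S : Type*} (n : ℕ) (y : (_ : Finset.Iic (n + 1)) → S) (z : S) :
    shiftHistory (n + 1) (snocHistory (n + 1) y z) = snocHistory n (shiftHistory n y) z := by
  funext i
  simp [shiftHistory, snocHistory]

theorem measurable_snocHistory (n : ℕ) (y : (_ : Finset.Iic n) → S) :
    Measurable (snocHistory n y) := by
  refine measurable_pi_lambda _ fun i => ?_
  unfold snocHistory
  split_ifs <;> fun_prop

variable (k : Kernel S S) [IsMarkovKernel k]

theorem partialTraj_succ_self_apply (n : ℕ) (y : (_ : Finset.Iic n) → S) :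
    Kernel.partialTraj (X := fun _ => S) (markovHistory k) n (n + 1) y
      = (k (y ⟨n, Finset.mem_Iic.2 le_rfl⟩)).map (snocHistory n y) := by
  have hm : Measurable (IicProdIoc (X := fun _ => S) n (n + 1)) := measurable_IicProdIoc
  have hp : Measurable (MeasurableEquiv.piSingleton (X := fun _ => S) n) :=
    (MeasurableEquiv.piSingleton (X := fun _ => S) n).measurable
  rw [Kernel.partialTraj_succ_self, Kernel.map_apply _ hm, Kernel.prod_apply,
    Kernel.id_apply, Measure.dirac_prod, Kernel.map_apply _ hp,
    Measure.map_map measurable_prodMk_left hp,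
    Measure.map_map hm (measurable_prodMk_left.comp hp)]
  congr 1
  funext z i
  simp only [Function.comp_apply, IicProdIoc, snocHistory]
  split_ifs
  · rfl
  · simp [MeasurableEquiv.piSingleton]

/-- The transition looks only at the last entry, so it commutes with forgetting the first one. -/
theorem partialTraj_succ_self_map_shift (n : ℕ) :
    (Kernel.partialTraj (X := fun _ => S) (markovHistory k) (n + 1) (n + 2)).map
        (shiftHistory (n + 1))
      = (Kernel.partialTraj (X := fun _ => S) (markovHistory k) n (n + 1)).comap (shiftHistory n)
        (measurable_shiftHistory n) := by
  ext1 y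
  rw [Kernel.map_apply _ (measurable_shiftHistory _), Kernel.comap_apply,
    partialTraj_succ_self_apply, partialTraj_succ_self_apply,
    Measure.map_map (measurable_shiftHistory _) (measurable_snocHistory _ _)]
  congr 1
  exact funext (shiftHistory_snocHistory n y)

theorem partialTraj_one_map_shift (n : ℕ) :
    (Kernel.partialTraj (X := fun _ => S) (markovHistory k) 1 (n + 1)).map (shiftHistory n)
      = (Kernel.partialTraj (X := fun _ => S) (markovHistory k) 0 n).comap (shiftHistory 0)
        (measurable_shiftHistory 0) := by
  induction n with
  | zero =>
    rw [Kernel.partialTraj_self, Kernel.partialTraj_self]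
    ext1 y
    rw [Kernel.map_apply _ (measurable_shiftHistory _), Kernel.comap_apply, Kernel.id_apply,
      Kernel.id_apply, Measure.map_dirac' (measurable_shiftHistory _)]
  | succ n ih =>
    rw [Kernel.partialTraj_succ_eq_comp (by lia : 1 ≤ n + 1), Kernel.map_comp,
      partialTraj_succ_self_map_shift, ← Kernel.comp_map _ _ (measurable_shiftHistory n), ih,
      Kernel.partialTraj_succ_eq_comp (by lia : 0 ≤ n)]
    ext1 y
    rw [Kernel.comp_apply, Kernel.comap_apply, Kernel.comap_apply, Kernel.comp_apply]

/-- Measures on sequences are determined by their finite-dimensional marginals. -/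
theorem measure_ext_of_map_frestrictLe {μ ν : Measure (ℕ → S)} [IsFiniteMeasure ν]
    (h : ∀ n, μ.map (Preorder.frestrictLe (π := fun _ => S) n)
      = ν.map (Preorder.frestrictLe (π := fun _ => S) n)) : μ = ν := by
  have hν : IsProjectiveMeasureFamily (α := fun _ : ℕ => S) fun I => ν.map I.restrict := by
    intro I J hJI
    rw [Measure.map_map (Finset.measurable_restrict₂ hJI) (Finset.measurable_restrict I)]
    rfl
  have h1 : IsProjectiveLimit (α := fun _ : ℕ => S) μ fun I => ν.map I.restrict :=
    (isProjectiveLimit_nat_iff hν μ).2 h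
  have h2 : IsProjectiveLimit (α := fun _ : ℕ => S) ν fun I => ν.map I.restrict := fun _ => rfl
  have (I : Finset ℕ) : IsFiniteMeasure (ν.map (I.restrict (π := fun _ => S))) := inferInstance
  exact h1.unique h2

/-- Markov property: given the first two entries, the shifted chain starts afresh from the second.
By uniqueness of projective limits it is enough to compare finite histories. -/
theorem traj_one_map_shift (y : (_ : Finset.Iic 1) → S) :
    (Kernel.traj (X := fun _ => S) (markovHistory k) 1 y).map (fun ω n => ω (n + 1))
      = Kernel.traj (X := fun _ => S) (markovHistory k) 0 (shiftHistory 0 y) := by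
  have hsh : Measurable fun (ω : ℕ → S) n => ω (n + 1) := by fun_prop
  refine measure_ext_of_map_frestrictLe fun n => ?_
  have h1 : (Preorder.frestrictLe (π := fun _ => S) n) ∘ (fun (ω : ℕ → S) n => ω (n + 1))
      = shiftHistory n ∘ Preorder.frestrictLe (π := fun _ => S) (n + 1) := rfl
  have hm (n : ℕ) : Measurable (Preorder.frestrictLe (π := fun _ : ℕ => S) n) :=
    Preorder.measurable_frestrictLe n
  rw [Measure.map_map (hm n) hsh, h1, ← Measure.map_map (measurable_shiftHistory n) (hm _),
    Kernel.traj_map_frestrictLe_apply, Kernel.traj_map_frestrictLe_apply,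
    ← Kernel.map_apply _ (measurable_shiftHistory n), partialTraj_one_map_shift,
    Kernel.comap_apply]

/-- First-step decomposition of the law of a homogeneous Markov chain. -/
theorem lintegral_traj_zero (s : S) {g : S → ℝ} (hg : Measurable g) {f : ℝ → (ℕ → S) → ℝ≥0∞}
    (hf : Measurable (Function.uncurry f)) :
    ∫⁻ ω, f (g (ω 0)) (fun n => ω (n + 1))
        ∂(Kernel.traj (X := fun _ => S) (markovHistory k) 0 fun _ => s)
      = ∫⁻ s', ∫⁻ ω, f (g s) ω
        ∂(Kernel.traj (X := fun _ => S) (markovHistory k) 0 fun _ => s') ∂(k s) := by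
  have hF : Measurable fun ω : ℕ → S => f (g (ω 0)) fun n => ω (n + 1) :=
    hf.comp (f := fun ω : ℕ → S => (g (ω 0), fun n => ω (n + 1))) (by fun_prop)
  have key (y : (_ : Finset.Iic 1) → S) :
      ∫⁻ ω, f (g (ω 0)) (fun n => ω (n + 1))
          ∂(Kernel.traj (X := fun _ => S) (markovHistory k) 1 y)
        = ∫⁻ ω, f (g (y ⟨0, by simp⟩)) ω
          ∂(Kernel.traj (X := fun _ => S) (markovHistory k) 0 fun _ => y ⟨1, by simp⟩) := by
    have hae : ∀ᵐ ω ∂(Kernel.traj (X := fun _ => S) (markovHistory k) 1 y),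
        g (ω 0) = g (y ⟨0, by simp⟩) := by
      -- Points of `S` need not be measurable. Looking at the initial state through the real-valued
      -- `g` gives a measurable event to test against the Dirac law.
      have hset : MeasurableSet {z : (_ : Finset.Iic 1) → S |
          g (z ⟨0, by simp⟩) = g (y ⟨0, by simp⟩)} :=
        measurableSet_eq_fun (by fun_prop) measurable_const
      have : ∀ᵐ z ∂((Kernel.traj (X := fun _ => S) (markovHistory k) 1 y).map
          (Preorder.frestrictLe 1)), g (z ⟨0, by simp⟩) = g (y ⟨0, by simp⟩) := by
        rw [Kernel.traj_map_frestrictLe_apply, Kernel.partialTraj_self, Kernel.id_apply,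
          ae_dirac_iff hset]
      exact ae_of_ae_map (by fun_prop) this
    rw [lintegral_congr_ae (g := fun ω => f (g (y ⟨0, by simp⟩)) fun n => ω (n + 1))
      (hae.mono fun ω h => by simp only [h])]
    have hfy : Measurable fun ω : ℕ → S => f (g (y ⟨0, by simp⟩)) ω := by fun_prop
    have hy : shiftHistory 0 y = fun _ => y ⟨1, by simp⟩ := by
      funext i
      have : i.1 = 0 := Nat.le_zero.1 (Finset.mem_Iic.1 i.2)
      simp [shiftHistory, this]
    rw [← hy, ← traj_one_map_shift, lintegral_map hfy (by fun_prop)]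
  have hcomp := Kernel.traj_comp_partialTraj (X := fun _ => S) (κ := markovHistory k)
    (Nat.zero_le 1)
  have hL : ∫⁻ ω, f (g (ω 0)) (fun n => ω (n + 1))
        ∂(Kernel.traj (X := fun _ => S) (markovHistory k) 0 fun _ => s)
      = ∫⁻ y, ∫⁻ ω, f (g (ω 0)) (fun n => ω (n + 1))
          ∂(Kernel.traj (X := fun _ => S) (markovHistory k) 1 y)
        ∂(Kernel.partialTraj (X := fun _ => S) (markovHistory k) 0 1 fun _ => s) := by
    rw [← Kernel.lintegral_comp _ _ _ hF, hcomp]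
  have hG : Measurable fun y : (_ : Finset.Iic 1) → S =>
      ∫⁻ ω, f (g (ω 0)) (fun n => ω (n + 1))
        ∂(Kernel.traj (X := fun _ => S) (markovHistory k) 1 y) := hF.lintegral_kernel
  rw [hL, partialTraj_succ_self_apply, lintegral_map hG (measurable_snocHistory _ _)]
  simp_rw [key]
  simp [snocHistory]

end MarkovChain

/-! ### Returns of a policy and the distributional Bellman equation -/

namespace MDP

variable {X A : Type*} [MeasurableSpace X] [MeasurableSpace A] (M : MDP X A) {R : ℝ}

theorem summable_return (hR : ∀ s, |M.r s| ≤ R) (ω : ℕ → X × A) :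
    Summable fun t => M.γ ^ t * M.r (ω t) := by
  refine Summable.of_norm_bounded
    ((summable_geometric_of_lt_one M.γ_pos.le M.γ_lt_one).mul_right R) fun t => ?_
  rw [norm_mul, norm_pow, Real.norm_of_nonneg M.γ_pos.le]
  exact mul_le_mul_of_nonneg_left (hR _) (pow_nonneg M.γ_pos.le t)

theorem abs_discountedReturn_le (hR : ∀ s, |M.r s| ≤ R) (ω : ℕ → X × A) :
    |M.discountedReturn ω| ≤ R / (1 - M.γ) := by
  have hg := (hasSum_geometric_of_lt_one M.γ_pos.le M.γ_lt_one).mul_right R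
  rw [inv_mul_eq_div] at hg
  refine tsum_of_norm_bounded (f := fun t => M.γ ^ t * M.r (ω t)) hg fun t => ?_
  rw [norm_mul, norm_pow, Real.norm_of_nonneg M.γ_pos.le]
  exact mul_le_mul_of_nonneg_left (hR _) (pow_nonneg M.γ_pos.le t)

theorem discountedReturn_eq (ω : ℕ → X × A) :
    M.discountedReturn ω = M.r (ω 0) + M.γ * M.discountedReturn fun n => ω (n + 1) := by
  obtain ⟨R, hR⟩ := M.bddMeasurable_r.2
  rw [discountedReturn, (M.summable_return hR ω).tsum_eq_zero_add, discountedReturn,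
    ← tsum_mul_left]
  simp [pow_succ', mul_assoc]

theorem measurable_discountedReturn : Measurable M.discountedReturn := by
  obtain ⟨hr, R, hR⟩ := M.bddMeasurable_r
  refine measurable_of_tendsto_metrizable
    (f := fun n ω => ∑ t ∈ Finset.range n, M.γ ^ t * M.r (ω t)) (fun n => by fun_prop) ?_
  exact tendsto_pi_nhds.2 fun ω => (M.summable_return hR ω).hasSum.tendsto_sum_nat

variable (π : Kernel X A) [hπ : IsMarkovKernel π]

theorem trajectory_apply (s : X × A) :
    M.trajectory π s
      = haveI := M.isMarkovKernel_stepKernel π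
        Kernel.traj (X := fun _ => X × A) (markovHistory (M.stepKernel π)) 0 fun _ => s := by
  rfl

theorem isMarkovKernel_trajectory : IsMarkovKernel (M.trajectory π) := by
  have := M.isMarkovKernel_stepKernel π
  refine ⟨fun s => ?_⟩
  rw [M.trajectory_apply]
  infer_instance

theorem returnDist_eq : M.returnDist π = (M.trajectory π).map M.discountedReturn :=
  dif_pos hπ

theorem isMarkovKernel_returnDist : IsMarkovKernel (M.returnDist π) := by
  have := M.isMarkovKernel_trajectory π
  rw [M.returnDist_eq π]
  exact Kernel.IsMarkovKernel.map _ M.measurable_discountedReturn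

theorem ae_abs_le_returnDist (hR : ∀ s, |M.r s| ≤ R) (s : X × A) :
    ∀ᵐ z ∂(M.returnDist π s), |z| ≤ R / (1 - M.γ) := by
  rw [M.returnDist_eq π, Kernel.map_apply _ M.measurable_discountedReturn,
    ae_map_iff M.measurable_discountedReturn.aemeasurable
      (measurableSet_le (by fun_prop) measurable_const)]
  exact ae_of_all _ (M.abs_discountedReturn_le hR)

/-- The distributional Bellman equation. -/
theorem lintegral_returnDist {f : ℝ → ℝ≥0∞} (hf : Measurable f) (s : X × A) :
    ∫⁻ z, f z ∂(M.returnDist π s)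
      = ∫⁻ s', ∫⁻ z, f (M.r s + M.γ * z) ∂(M.returnDist π s') ∂(M.stepKernel π s) := by
  have := M.isMarkovKernel_stepKernel π
  have hG := M.measurable_discountedReturn
  simp_rw [M.returnDist_eq π, Kernel.map_apply _ hG]
  rw [lintegral_map hf hG]
  have h1 (s' : X × A) : ∫⁻ z, f (M.r s + M.γ * z) ∂((M.trajectory π s').map M.discountedReturn)
      = ∫⁻ ω, f (M.r s + M.γ * M.discountedReturn ω) ∂(M.trajectory π s') :=
    lintegral_map (by fun_prop) hG
  simp_rw [h1, M.trajectory_apply π]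
  rw [← lintegral_traj_zero (M.stepKernel π) s M.bddMeasurable_r.1
    (f := fun y ω => f (y + M.γ * M.discountedReturn ω)) (by fun_prop)]
  exact lintegral_congr fun ω => by rw [M.discountedReturn_eq]

theorem returnDist_apply (s : X × A) :
    M.returnDist π s
      = ((M.stepKernel π).compProd (Kernel.prodMkLeft (X × A) (M.returnDist π)) s).map
        fun w => M.r s + M.γ * w.2 := by
  have := M.isMarkovKernel_stepKernel π
  have := M.isMarkovKernel_returnDist π
  refine Measure.ext_of_lintegral _ fun f hf => ?_
  rw [M.lintegral_returnDist π hf, lintegral_map hf (by fun_prop),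
    Kernel.lintegral_compProd _ _ _ (by fun_prop)]
  rfl

theorem lintegral_enorm_returnDist_le (hR : ∀ s, |M.r s| ≤ R) (s : X × A) :
    ∫⁻ z, ‖z‖ₑ ∂(M.returnDist π s) ≤ ENNReal.ofReal (R / (1 - M.γ)) := by
  have := M.isMarkovKernel_returnDist π
  refine (lintegral_mono_ae ((M.ae_abs_le_returnDist π hR s).mono fun z hz => ?_)).trans_eq
    (by simp : ∫⁻ _, ENNReal.ofReal (R / (1 - M.γ)) ∂(M.returnDist π s) = _)
  rw [Real.enorm_eq_ofReal_abs]
  exact ENNReal.ofReal_le_ofReal hz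

theorem bddMeasurable_actionValue : BddMeasurable (M.actionValue π) := by
  obtain ⟨R, hR⟩ := M.bddMeasurable_r.2
  have := M.isMarkovKernel_returnDist π
  exact bddMeasurable_meanFn (M.lintegral_enorm_returnDist_le π hR)

/-- The Bellman equation for the action values of a policy. -/
theorem actionValue_eq (s : X × A) :
    M.actionValue π s = M.r s + M.γ * ∫ x, ∫ a, M.actionValue π (x, a) ∂(π x) ∂(M.P s) := by
  obtain ⟨R, hR⟩ := M.bddMeasurable_r.2
  have := M.isMarkovKernel_returnDist π
  have h := M.integral_affine_return (π := π) (M.lintegral_enorm_returnDist_le π hR)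
    (measurable_const (a := (0 : ℝ))) (D := 0) (by simp) s
  simp only [mul_zero, sub_zero] at h
  unfold actionValue
  rw [← h, meanFn, M.returnDist_apply π, integral_map (by fun_prop) (by fun_prop)]

end MDP

/-! ### Moment control above a level -/

section Excess

/-- The `p`-th power of the excess of `|z|` over the level `B`. -/
noncomputable def excess (p B z : ℝ) : ℝ≥0∞ := ENNReal.ofReal (max (|z| - B) 0 ^ p)

@[fun_prop]
theorem measurable_excess (p B : ℝ) : Measurable (excess p B) := by
  unfold excess; fun_prop

variable {p B : ℝ}

theorem excess_eq_zero (hp : 1 ≤ p) {z : ℝ} (hz : |z| ≤ B) : excess p B z = 0 := by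
  rw [excess, max_eq_right (by linarith), Real.zero_rpow (by linarith), ENNReal.ofReal_zero]

theorem excess_le_rpow (hp : 1 ≤ p) (hB : 0 ≤ B) (z : ℝ) :
    excess p B z ≤ ENNReal.ofReal (|z| ^ p) := by
  refine ENNReal.ofReal_le_ofReal (Real.rpow_le_rpow (le_max_right _ _) ?_ (by linarith))
  exact max_le (by linarith) (abs_nonneg z)

/-- Since `|b + γ z| - B ≤ γ (|z| - B)`, the ball of radius `B` is stable and the part outside it
contracts. The factor `γ ^ p` is weakened to `γ`. -/
theorem excess_affine_le (hp : 1 ≤ p) {γ b : ℝ} (hγ0 : 0 < γ) (hγ1 : γ ≤ 1)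
    (hb : |b| ≤ (1 - γ) * B) (z : ℝ) :
    excess p B (b + γ * z) ≤ ENNReal.ofReal γ * excess p B z := by
  have hm : 0 ≤ max (|z| - B) 0 := le_max_right _ _
  rw [excess, excess, ← ENNReal.ofReal_mul hγ0.le]
  refine ENNReal.ofReal_le_ofReal ?_
  calc max (|b + γ * z| - B) 0 ^ p ≤ (γ * max (|z| - B) 0) ^ p := by
        refine Real.rpow_le_rpow (le_max_right _ _) (max_le ?_ (by positivity)) (by linarith)
        have h1 := abs_add_le b (γ * z)
        rw [abs_mul, abs_of_pos hγ0] at h1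
        have h2 := mul_le_mul_of_nonneg_left (le_max_left (|z| - B) 0) hγ0.le
        linarith
    _ = γ ^ p * max (|z| - B) 0 ^ p := Real.mul_rpow hγ0.le hm
    _ ≤ γ * max (|z| - B) 0 ^ p := by
        gcongr
        simpa using Real.rpow_le_rpow_of_exponent_ge hγ0 hγ1 hp

theorem enorm_le_add_excess (hp : 1 ≤ p) (hB : 0 ≤ B) (z : ℝ) :
    ‖z‖ₑ ≤ ENNReal.ofReal (B + 1) + excess p B z := by
  have hm : 0 ≤ max (|z| - B) 0 := le_max_right _ _
  rw [Real.enorm_eq_ofReal_abs, excess, ← ENNReal.ofReal_add (by linarith) (by positivity)]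
  refine ENNReal.ofReal_le_ofReal ?_
  have h1 := le_max_left (|z| - B) 0
  rcases le_total (max (|z| - B) 0) 1 with h | h
  · have : 0 ≤ max (|z| - B) 0 ^ p := by positivity
    linarith
  · have := Real.self_le_rpow_of_one_le h hp
    linarith

/-- `|z|` is at most twice the larger of `B` and the excess. -/
theorem rpow_le_add_excess (hp : 1 ≤ p) (hB : 0 ≤ B) (z : ℝ) :
    ENNReal.ofReal (|z| ^ p)
      ≤ ENNReal.ofReal ((2 * B) ^ p) + ENNReal.ofReal (2 ^ p) * excess p B z := by
  have hm : 0 ≤ max (|z| - B) 0 := le_max_right _ _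
  rw [excess, ← ENNReal.ofReal_mul (by positivity), ← Real.mul_rpow (by norm_num) hm,
    ← ENNReal.ofReal_add (by positivity) (by positivity)]
  refine ENNReal.ofReal_le_ofReal ?_
  have h1 := le_max_left (|z| - B) 0
  have hp0 : 0 ≤ p := by linarith
  rcases le_total (max (|z| - B) 0) B with h | h
  · have := Real.rpow_le_rpow (abs_nonneg z) (by linarith : |z| ≤ 2 * B) hp0
    have : 0 ≤ (2 * max (|z| - B) 0) ^ p := by positivity
    linarith
  · have := Real.rpow_le_rpow (abs_nonneg z) (by linarith : |z| ≤ 2 * max (|z| - B) 0) hp0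
    have : 0 ≤ (2 * B) ^ p := by positivity
    linarith

theorem lintegral_enorm_le_of_excess {μ : Measure ℝ} [IsProbabilityMeasure μ] (hp : 1 ≤ p)
    (hB : 0 ≤ B) {m : ℝ≥0∞} (hm : m ≠ ⊤) (h : ∫⁻ z, excess p B z ∂μ ≤ m) :
    ∫⁻ z, ‖z‖ₑ ∂μ ≤ ENNReal.ofReal (B + 1 + m.toReal) := by
  refine (lintegral_mono (enorm_le_add_excess hp hB)).trans ?_
  rw [lintegral_add_left measurable_const,
    ENNReal.ofReal_add (by linarith : 0 ≤ B + 1) ENNReal.toReal_nonneg, ENNReal.ofReal_toReal hm]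
  simpa using h

end Excess

/-! ### Moments and means along the iterations -/

namespace MDP

variable {X A : Type*} [MeasurableSpace X] [MeasurableSpace A] (M : MDP X A)
  (πref : Kernel X A) {p B R Q : ℝ} {m : ℝ≥0∞}

section Step

variable {τ : ℝ} {q : X × A → ℝ}

theorem klCost_nonneg (hτ : 0 < τ) (π : Kernel X A) (x : X) : 0 ≤ klCost πref τ π x := by
  unfold klCost; positivity

theorem lintegral_excess_softEval_le {π : Kernel X A} [IsMarkovKernel π] {ζ : Kernel (X × A) ℝ}
    [IsMarkovKernel ζ] (hp : 1 ≤ p) (hk : Measurable (klCost πref τ π)) {K : ℝ}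
    (hK : ∀ x, |klCost πref τ π x| ≤ K) (hR : ∀ s, |M.r s| ≤ R)
    (hB : R + M.γ * K ≤ (1 - M.γ) * B) (hζ : ∀ s, ∫⁻ z, excess p B z ∂(ζ s) ≤ m) (s : X × A) :
    ∫⁻ z, excess p B z ∂(M.softEval πref τ π ζ s) ≤ ENNReal.ofReal M.γ * m := by
  have := M.isMarkovKernel_stepKernel π
  rw [M.lintegral_softEval hk (by fun_prop)]
  calc _ ≤ ∫⁻ s', ENNReal.ofReal M.γ * m ∂(M.stepKernel π s) := by
        refine lintegral_mono fun s' => ?_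
        refine le_trans ?_ (mul_le_mul_right (hζ s') _)
        rw [← lintegral_const_mul _ (by fun_prop)]
        refine lintegral_mono fun z => ?_
        have hb : |M.r s - M.γ * klCost πref τ π s'.1| ≤ (1 - M.γ) * B := by
          refine ((abs_sub _ _).trans (add_le_add (hR s) ?_)).trans hB
          rw [abs_mul, abs_of_pos M.γ_pos]
          exact mul_le_mul_of_nonneg_left (hK _) M.γ_pos.le
        have := excess_affine_le hp M.γ_pos M.γ_lt_one.le hb z
        rwa [sub_add_eq_add_sub] at this
    _ = _ := by simp

variable [IsMarkovKernel πref]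

theorem measurable_klCost_boltzmann (hq : BddMeasurable q) (hτ : 0 < τ) :
    Measurable (klCost πref τ (boltzmann πref τ q)) :=
  (measurable_klDiv_boltzmann πref hq hτ).const_mul τ

theorem abs_klCost_boltzmann_le (hq : BddMeasurable q) (hτ : 0 < τ) (hQ : ∀ s, |q s| ≤ Q)
    (x : X) : |klCost πref τ (boltzmann πref τ q) x| ≤ 2 * Q := by
  rw [abs_of_nonneg (klCost_nonneg πref hτ _ x)]
  exact mul_klDiv_boltzmann_le πref hq hτ hQ x

theorem integral_boltzmann_sub_klCost (hq : BddMeasurable q) (hτ : 0 < τ) (x : X) :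
    ∫ a, q (x, a) ∂(boltzmann πref τ q x) - klCost πref τ (boltzmann πref τ q) x
      = softValue πref τ q x := by
  rw [klCost, mul_klDiv_boltzmann πref hq hτ, sub_sub_cancel]

end Step

section Iterates

variable [IsMarkovKernel πref] {σ : ℝ} {ζ₀ : Kernel (X × A) ℝ}

theorem controlIterate_succ (n : ℕ) :
    M.controlIterate πref σ ζ₀ (n + 1)
      = M.softEval πref σ (boltzmann πref σ (meanFn (M.controlIterate πref σ ζ₀ n)))
        (M.controlIterate πref σ ζ₀ n) :=
  Function.iterate_succ_apply' _ _ _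

/-- The invariants must be carried together: bounded means bound the KL cost by `2 * Q`, which keeps
the level `B` stable, and the excess bound makes the next mean integrable. The mean of one step is a
soft Bellman update because expected value minus KL cost is the soft value. -/
theorem controlIterate_spec (hp : 1 ≤ p) (hσ : 0 < σ) (hm : m ≠ ⊤) (hB0 : 0 ≤ B)
    (hR : ∀ s, |M.r s| ≤ R) (hQ : R + M.γ * Q ≤ Q) (hB : R + M.γ * (2 * Q) ≤ (1 - M.γ) * B)
    (hζ₀ : IsMarkovKernel ζ₀) (h₀ : ∀ s, ∫⁻ z, excess p B z ∂(ζ₀ s) ≤ m)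
    (hQ₀ : ∀ s, |meanFn ζ₀ s| ≤ Q) (n : ℕ) :
    IsMarkovKernel (M.controlIterate πref σ ζ₀ n) ∧
      (∀ s, ∫⁻ z, excess p B z ∂(M.controlIterate πref σ ζ₀ n s) ≤ m) ∧
      (∀ s, |meanFn (M.controlIterate πref σ ζ₀ n) s| ≤ Q) ∧
      meanFn (M.controlIterate πref σ ζ₀ n) = (M.softBellman πref σ)^[n] (meanFn ζ₀) := by
  have := M.markov_P
  induction n with
  | zero => exact ⟨hζ₀, h₀, hQ₀, rfl⟩
  | succ n ih =>
    obtain ⟨ih1, ih2, ih3, ih4⟩ := ih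
    set ζ := M.controlIterate πref σ ζ₀ n
    have hen (s) := lintegral_enorm_le_of_excess hp hB0 hm (ih2 s)
    have hq := bddMeasurable_meanFn hen
    have := isMarkovKernel_boltzmann πref hq hσ
    have hk := measurable_klCost_boltzmann πref hq hσ
    have hK := abs_klCost_boltzmann_le πref hq hσ ih3
    have hmean : meanFn (M.controlIterate πref σ ζ₀ (n + 1))
        = M.softBellman πref σ (meanFn ζ) := by
      funext s
      rw [controlIterate_succ, M.meanFn_softEval hen hk hK, softBellman]
      simp_rw [integral_boltzmann_sub_klCost πref hq hσ]
    refine ⟨?_, fun s => ?_, fun s => ?_, ?_⟩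
    · rw [controlIterate_succ]
      exact M.isMarkovKernel_softEval hk
    · rw [controlIterate_succ]
      refine (M.lintegral_excess_softEval_le πref hp hk hK hR hB ih2 s).trans ?_
      exact mul_le_of_le_one_left zero_le (by simpa using M.γ_lt_one.le)
    · rw [hmean, softBellman]
      refine ((abs_add_le _ _).trans (add_le_add (hR s) ?_)).trans hQ
      rw [abs_mul, abs_of_pos M.γ_pos]
      exact mul_le_mul_of_nonneg_left (abs_integral_le_of_bound fun x =>
        abs_softValue_le πref hq hσ fun a => ih3 (x, a)) M.γ_pos.le
    · rw [hmean, ih4, Function.iterate_succ_apply']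

theorem abs_iterate_softBellman_sub_le (hσ : 0 < σ) {q : X × A → ℝ} (hq : BddMeasurable q)
    {C : ℝ} (hC : ∀ s, |q s - M.qSoft πref σ s| ≤ C) (n : ℕ) :
    BddMeasurable ((M.softBellman πref σ)^[n] q) ∧
      ∀ s, |(M.softBellman πref σ)^[n] q s - M.qSoft πref σ s| ≤ M.γ ^ n * C := by
  obtain ⟨hs, hsf⟩ := M.qSoft_spec πref hσ
  induction n with
  | zero => exact ⟨hq, by simpa using hC⟩
  | succ n ih =>
    rw [Function.iterate_succ_apply']
    refine ⟨M.bddMeasurable_softBellman πref hσ ih.1, fun s => ?_⟩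
    nth_rw 1 [← hsf]
    refine (M.abs_softBellman_sub_le πref hσ ih.1 hs ih.2 s).trans_eq ?_
    ring

theorem exists_abs_iterate_softBellman_sub_le (hσ : 0 < σ) {q : X × A → ℝ}
    (hq : BddMeasurable q) {e : ℝ} (he : 0 < e) :
    ∃ n : ℕ, ∀ s, |(M.softBellman πref σ)^[n] q s - M.qSoft πref σ s| ≤ e := by
  obtain ⟨C, hC⟩ := hq.2
  obtain ⟨D, hD⟩ := (M.qSoft_spec πref hσ).1.2
  have ht : Tendsto (fun n : ℕ => M.γ ^ n * (C + D)) atTop (𝓝 0) := by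
    simpa using (tendsto_pow_atTop_nhds_zero_of_lt_one M.γ_pos.le M.γ_lt_one).mul_const (C + D)
  obtain ⟨n, hn⟩ := (ht.eventually (ge_mem_nhds he)).exists
  exact ⟨n, fun s => ((M.abs_iterate_softBellman_sub_le πref hσ hq
    (fun s => (abs_sub _ _).trans (add_le_add (hC s) (hD s))) n).2 s).trans hn⟩

end Iterates

/-! ### Soft evaluation near the reference-optimal values -/

section Evaluation

variable {πref} [IsMarkovKernel πref] {c η τ : ℝ} {q : X × A → ℝ}

theorem abs_softValue_sub_essSup_le (hτ : 0 < τ) (hc : 0 < c)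
    (hcov : ∀ x, ENNReal.ofReal c ≤ πref x (optActions πref (M.qRef πref) x))
    (hq : BddMeasurable q) (hη : ∀ s, |q s - M.qRef πref s| ≤ η) (x : X) :
    |softValue πref τ q x - essSup (fun a => M.qRef πref (x, a)) (πref x)|
      ≤ τ * Real.log c⁻¹ + η := by
  obtain ⟨hr, -⟩ := M.qRef_spec πref
  have h1 := abs_le.1 (abs_softValue_sub_le πref hq hr hτ fun a => hη (x, a))
  have h2 := softValue_le_essSup πref hr hτ x
  have h3 := essSup_sub_le_softValue πref hr hτ hc (hcov x)
  exact abs_le.2 ⟨by linarith [h1.1], by linarith [h1.2]⟩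

/-- Soft evaluation of a Boltzmann-Gibbs policy of a function close to the reference-optimal values
stays close to the reference-optimal values. -/
theorem iterate_softEval_spec (hp : 1 ≤ p) (hτ : 0 < τ) (hm : m ≠ ⊤) (hB0 : 0 ≤ B)
    (hR : ∀ s, |M.r s| ≤ R) (hB : R + M.γ * (2 * Q) ≤ (1 - M.γ) * B)
    (hc : 0 < c) (hc1 : c ≤ 1)
    (hcov : ∀ x, ENNReal.ofReal c ≤ πref x (optActions πref (M.qRef πref) x))
    {ζ : Kernel (X × A) ℝ} (hζ : IsMarkovKernel ζ) (h₀ : ∀ s, ∫⁻ z, excess p B z ∂(ζ s) ≤ m)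
    (hQ : ∀ s, |meanFn ζ s| ≤ Q) (hη0 : 0 ≤ η) (hη : ∀ s, |meanFn ζ s - M.qRef πref s| ≤ η)
    (n : ℕ) :
    IsMarkovKernel ((M.softEval πref τ (boltzmann πref τ (meanFn ζ)))^[n] ζ) ∧
      (∀ s, ∫⁻ z, excess p B z ∂((M.softEval πref τ (boltzmann πref τ (meanFn ζ)))^[n] ζ s)
        ≤ ENNReal.ofReal M.γ ^ n * m) ∧
      ∀ s, |meanFn ((M.softEval πref τ (boltzmann πref τ (meanFn ζ)))^[n] ζ) s - M.qRef πref s|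
        ≤ (τ * Real.log c⁻¹ + 2 * η) / (1 - M.γ) := by
  have := M.markov_P
  have hγ0 := M.γ_pos
  have hγ1 := M.γ_lt_one
  have hL : 0 ≤ τ * Real.log c⁻¹ :=
    mul_nonneg hτ.le (Real.log_nonneg ((one_le_inv₀ hc).2 hc1))
  have hq := bddMeasurable_meanFn fun s => lintegral_enorm_le_of_excess hp hB0 hm (h₀ s)
  have hMK := isMarkovKernel_boltzmann πref hq hτ
  have hk := measurable_klCost_boltzmann πref hq hτ
  have hK := abs_klCost_boltzmann_le πref hq hτ hQ
  obtain ⟨hr, hrf⟩ := M.qRef_spec πref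
  obtain ⟨C, hC⟩ := hr.2
  induction n with
  | zero =>
    refine ⟨hζ, by simpa using h₀, fun s => (hη s).trans ?_⟩
    rw [le_div_iff₀ (by linarith)]
    nlinarith
  | succ n ih =>
    rw [Function.iterate_succ_apply']
    set π := boltzmann πref τ (meanFn ζ)
    obtain ⟨ih1, ih2, ih3⟩ := ih
    set ξ := (M.softEval πref τ π)^[n] ζ
    have hm' : ENNReal.ofReal M.γ ^ n * m ≠ ⊤ :=
      ENNReal.mul_ne_top (ENNReal.pow_ne_top ENNReal.ofReal_ne_top) hm
    have hen (s) := lintegral_enorm_le_of_excess hp hB0 hm' (ih2 s)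
    have hξ := bddMeasurable_meanFn hen
    refine ⟨M.isMarkovKernel_softEval hk, fun s => ?_, fun s => ?_⟩
    · refine (M.lintegral_excess_softEval_le πref hp hk hK hR hB ih2 s).trans_eq ?_
      rw [pow_succ', mul_assoc]
    · set D := (τ * Real.log c⁻¹ + 2 * η) / (1 - M.γ) with hD
      have hDe : D * (1 - M.γ) = τ * Real.log c⁻¹ + 2 * η := div_mul_cancel₀ _ (by linarith)
      have hD0 : 0 ≤ D := div_nonneg (by linarith) (by linarith)
      obtain ⟨E, hE⟩ := hξ.2
      rw [M.meanFn_softEval hen hk hK]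
      nth_rw 1 [← hrf]
      -- Error budget: `D` to replace the current mean by `qRef` under `π`, `η` to replace `qRef` by
      -- the mean of `ζ`, and `τ log c⁻¹ + η` for the soft value of the latter.
      refine (M.abs_bellman_sub_le (C := E + 2 * Q) (C' := C) (c := D + (τ * Real.log c⁻¹ + 2 * η))
        ((measurable_integral_kernel hξ.1).sub hk) (measurable_essSup_kernel πref hr)
        (fun x => (abs_sub _ _).trans (add_le_add
          (abs_integral_le_of_bound fun a => hE (x, a)) (hK x)))
        (fun x => abs_essSup_le fun a => hC (x, a)) (fun x => ?_) s).trans ?_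
      · change |∫ a, meanFn ξ (x, a) ∂(π x) - klCost πref τ π x
          - essSup (fun a => M.qRef πref (x, a)) (πref x)| ≤ _
        have e1 : ∫ a, meanFn ζ (x, a) ∂(π x) - klCost πref τ π x = softValue πref τ (meanFn ζ) x :=
          integral_boltzmann_sub_klCost πref hq hτ x
        have e2 := abs_le.1 (M.abs_softValue_sub_essSup_le hτ hc hcov hq hη x)
        have i1 : Integrable (fun a => meanFn ξ (x, a)) (π x) :=
          integrable_of_measurable_of_bound (hξ.1.comp measurable_prodMk_left) fun a => hE (x, a)
        have i2 : Integrable (fun a => M.qRef πref (x, a)) (π x) :=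
          integrable_of_measurable_of_bound (hr.1.comp measurable_prodMk_left) fun a => hC (x, a)
        have i3 : Integrable (fun a => meanFn ζ (x, a)) (π x) :=
          integrable_of_measurable_of_bound (hq.1.comp measurable_prodMk_left) fun a => hQ (x, a)
        have e3 := abs_le.1 (abs_integral_sub_le i1 i2 fun a => ih3 (x, a))
        have e4 := abs_le.1 (abs_integral_sub_le i3 i2 fun a => hη (x, a))
        exact abs_le.2 ⟨by linarith [e2.1, e3.1, e4.2], by linarith [e2.2, e3.2, e4.1]⟩
      · rw [← hDe]
        -- With `hDe` the bound is `γ (D + D (1 - γ)) = D (1 - (1 - γ)²)`, which is at most `D`.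
        nlinarith [mul_nonneg hD0 (sq_nonneg (1 - M.γ))]

/-- The Boltzmann-Gibbs policy of a function close to the reference-optimal values is nearly
reference-optimal. -/
theorem isRefOptimal_boltzmann (hτ : 0 < τ) (hc : 0 < c)
    (hcov : ∀ x, ENNReal.ofReal c ≤ πref x (optActions πref (M.qRef πref) x))
    (hq : BddMeasurable q) (hη : ∀ s, |q s - M.qRef πref s| ≤ η) :
    M.IsRefOptimal πref (M.γ * (τ * Real.log c⁻¹ + 2 * η) / (1 - M.γ)) (boltzmann πref τ q) := by
  have hπ := isMarkovKernel_boltzmann πref hq hτ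
  have := M.markov_P
  set π := boltzmann πref τ q
  obtain ⟨hr, hrf⟩ := M.qRef_spec πref
  obtain ⟨C, hC⟩ := hr.2
  have hv := M.bddMeasurable_actionValue π
  obtain ⟨D, hD⟩ := hv.2
  obtain ⟨E, hE⟩ := hq.2
  refine ⟨hπ, fun s => ?_⟩
  rw [sub_le_comm]
  refine le_of_self_improving (f := fun s => M.qRef πref s - M.actionValue π s) (C := C + D)
    M.γ_lt_one (fun s => by linarith [(abs_le.1 (hC s)).2, (abs_le.1 (hD s)).1]) ?_ s
  intro e he s
  rw [M.actionValue_eq π]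
  nth_rw 1 [← hrf]
  rw [refBellman, add_sub_add_left_eq_sub, ← mul_sub]
  refine mul_le_mul_of_nonneg_left ?_ M.γ_pos.le
  have j1 : Integrable (fun x => essSup (fun a => M.qRef πref (x, a)) (πref x)) (M.P s) :=
    integrable_of_measurable_of_bound (measurable_essSup_kernel πref hr)
      fun x => abs_essSup_le fun a => hC (x, a)
  have j2 : Integrable (fun x => ∫ a, M.actionValue π (x, a) ∂(π x)) (M.P s) :=
    integrable_of_measurable_of_bound (measurable_integral_kernel hv.1)
      fun x => abs_integral_le_of_bound fun a => hD (x, a)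
  rw [← integral_sub j1 j2]
  refine (integral_mono (j1.sub j2) (integrable_const (τ * Real.log c⁻¹ + 2 * η + e))
    fun x => ?_).trans_eq (by simp)
  -- As KL is nonnegative, the policy attains at least the soft value of `q`. Passing from `q` to
  -- `qRef` costs another `η`, and from `qRef` to the action value of `π` the current bound `e`.
  have e1 := softValue_le_integral_boltzmann πref hq hτ x
  have e2 := abs_le.1 (M.abs_softValue_sub_essSup_le hτ hc hcov hq hη x)
  have i1 : Integrable (fun a => M.actionValue π (x, a)) (π x) :=
    integrable_of_measurable_of_bound (hv.1.comp measurable_prodMk_left) fun a => hD (x, a)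
  have i2 : Integrable (fun a => M.qRef πref (x, a)) (π x) :=
    integrable_of_measurable_of_bound (hr.1.comp measurable_prodMk_left) fun a => hC (x, a)
  have i3 : Integrable (fun a => q (x, a)) (π x) :=
    integrable_of_measurable_of_bound (hq.1.comp measurable_prodMk_left) fun a => hE (x, a)
  have e4 := abs_le.1 (abs_integral_sub_le i3 i2 fun a => hη (x, a))
  have e5 : ∫ a, M.qRef πref (x, a) ∂(π x) - ∫ a, M.actionValue π (x, a) ∂(π x) ≤ e := by
    rw [← integral_sub i2 i1]
    exact (integral_mono (i2.sub i1) (integrable_const e) fun a => he (x, a)).trans_eq (by simp)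
  show essSup (fun a => M.qRef πref (x, a)) (πref x) - ∫ a, M.actionValue π (x, a) ∂(π x) ≤ _
  linarith [e2.1, e4.2]

end Evaluation

end MDP

/-! ### Wasserstein bounds from sub-couplings -/

section Coupling

theorem measure_le_of_lintegral_le {Ω : Type*} [MeasurableSpace Ω] {μ ν : Measure Ω}
    (h : ∀ f : Ω → ℝ≥0∞, Measurable f → ∫⁻ ω, f ω ∂μ ≤ ∫⁻ ω, f ω ∂ν) : μ ≤ ν := by
  refine Measure.le_iff.2 fun t ht => ?_
  simpa [lintegral_indicator_one ht] using h (t.indicator 1) (measurable_one.indicator ht)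

variable {p : ℝ}

theorem ofReal_abs_sub_rpow_le (hp : 1 ≤ p) (x y : ℝ) :
    ENNReal.ofReal (|x - y| ^ p)
      ≤ ENNReal.ofReal (2 ^ p) * (ENNReal.ofReal (|x| ^ p) + ENNReal.ofReal (|y| ^ p)) := by
  have hp0 : 0 ≤ p := by linarith
  rw [← ENNReal.ofReal_add (by positivity) (by positivity), ← ENNReal.ofReal_mul (by positivity)]
  refine ENNReal.ofReal_le_ofReal ?_
  have h1 := abs_sub x y
  have hx : 0 ≤ 2 ^ p * |x| ^ p := by positivity
  have hy : 0 ≤ 2 ^ p * |y| ^ p := by positivity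
  rw [mul_add]
  rcases le_total |x| |y| with h | h
  · have h2 := Real.rpow_le_rpow (abs_nonneg _) (by linarith : |x - y| ≤ 2 * |y|) hp0
    rw [Real.mul_rpow (by norm_num) (abs_nonneg _)] at h2
    linarith
  · have h2 := Real.rpow_le_rpow (abs_nonneg _) (by linarith : |x - y| ≤ 2 * |x|) hp0
    rw [Real.mul_rpow (by norm_num) (abs_nonneg _)] at h2
    linarith

theorem lintegral_rpow_le_of_excess (hp : 1 ≤ p) {B : ℝ} (hB : 0 ≤ B) (μ : Measure ℝ) :
    ∫⁻ z, ENNReal.ofReal (|z| ^ p) ∂μ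
      ≤ ENNReal.ofReal ((2 * B) ^ p) * μ Set.univ
        + ENNReal.ofReal (2 ^ p) * ∫⁻ z, excess p B z ∂μ := by
  refine (lintegral_mono (rpow_le_add_excess hp hB)).trans_eq ?_
  rw [lintegral_add_left measurable_const, lintegral_const, lintegral_const_mul _ (by fun_prop)]

theorem lintegral_prod_abs_sub_rpow_le (hp : 1 ≤ p) (μ ν : Measure ℝ) [IsFiniteMeasure μ]
    [IsFiniteMeasure ν] :
    ∫⁻ z, ENNReal.ofReal (|z.1 - z.2| ^ p) ∂(μ.prod ν)
      ≤ ENNReal.ofReal (2 ^ p) * ((∫⁻ z, ENNReal.ofReal (|z| ^ p) ∂μ) * ν Set.univ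
        + (∫⁻ z, ENNReal.ofReal (|z| ^ p) ∂ν) * μ Set.univ) := by
  rw [lintegral_prod _ (by fun_prop)]
  calc _ ≤ ∫⁻ x, ∫⁻ y, ENNReal.ofReal (2 ^ p) *
        (ENNReal.ofReal (|x| ^ p) + ENNReal.ofReal (|y| ^ p)) ∂ν ∂μ :=
        lintegral_mono fun x => lintegral_mono fun y => ofReal_abs_sub_rpow_le hp x y
    _ = _ := by
        have h1 (x : ℝ) : ∫⁻ y, ENNReal.ofReal (2 ^ p) *
            (ENNReal.ofReal (|x| ^ p) + ENNReal.ofReal (|y| ^ p)) ∂ν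
            = ENNReal.ofReal (2 ^ p) * (ENNReal.ofReal (|x| ^ p) * ν Set.univ
              + ∫⁻ y, ENNReal.ofReal (|y| ^ p) ∂ν) := by
          rw [lintegral_const_mul _ (by fun_prop), lintegral_add_left measurable_const,
            lintegral_const]
        simp_rw [h1]
        rw [lintegral_const_mul _ (by fun_prop), lintegral_add_left (by fun_prop),
          lintegral_const, lintegral_mul_const _ (by fun_prop)]

/-- A sub-coupling, completed to a coupling by the normalized product of what the marginals leave
over. -/
theorem wass_le_of_add_eq (hp : 1 ≤ p) {μ ν ρ₁ ρ₂ : Measure ℝ} [IsFiniteMeasure ρ₁]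
    [IsFiniteMeasure ρ₂] {κ : Measure (ℝ × ℝ)} (e1 : κ.map Prod.fst + ρ₁ = μ)
    (e2 : κ.map Prod.snd + ρ₂ = ν) {d : ℝ≥0∞} (hd : d ≠ ⊤) (u1 : ρ₁ Set.univ = d)
    (u2 : ρ₂ Set.univ = d) :
    wass p μ ν ≤ (∫⁻ z, ENNReal.ofReal (|z.1 - z.2| ^ p) ∂κ + ENNReal.ofReal (2 ^ p) *
      (∫⁻ z, ENNReal.ofReal (|z| ^ p) ∂ρ₁ + ∫⁻ z, ENNReal.ofReal (|z| ^ p) ∂ρ₂)) ^ (1 / p) := by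
  -- If `d = 0` the leftover measures vanish, so the infinite factor `d⁻¹` is harmless.
  have hs (ρ : Measure ℝ) (hρ : ρ Set.univ = d) : d⁻¹ • d • ρ = ρ := by
    rcases eq_or_ne d 0 with h | h
    · rw [Measure.measure_univ_eq_zero.1 (hρ.trans h)]; simp
    · rw [smul_smul, ENNReal.inv_mul_cancel h hd, one_smul]
  have hc1 : (κ + d⁻¹ • ρ₁.prod ρ₂).map Prod.fst = μ := by
    rw [Measure.map_add _ _ measurable_fst, Measure.map_smul, Measure.map_fst_prod, u2, hs _ u1, e1]
  have hc2 : (κ + d⁻¹ • ρ₁.prod ρ₂).map Prod.snd = ν := by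
    rw [Measure.map_add _ _ measurable_snd, Measure.map_smul, Measure.map_snd_prod, u1, hs _ u2, e2]
  have hcost : ∫⁻ z, ENNReal.ofReal (|z.1 - z.2| ^ p) ∂(κ + d⁻¹ • ρ₁.prod ρ₂)
      ≤ ∫⁻ z, ENNReal.ofReal (|z.1 - z.2| ^ p) ∂κ + ENNReal.ofReal (2 ^ p) *
        (∫⁻ z, ENNReal.ofReal (|z| ^ p) ∂ρ₁ + ∫⁻ z, ENNReal.ofReal (|z| ^ p) ∂ρ₂) := by
    rw [lintegral_add_measure, lintegral_smul_measure, smul_eq_mul]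
    refine add_le_add le_rfl ?_
    refine (mul_le_mul_right (lintegral_prod_abs_sub_rpow_le hp ρ₁ ρ₂) _).trans ?_
    rw [u1, u2, ← add_mul, mul_comm (_ + _) d, mul_left_comm _ d, ← mul_assoc]
    exact mul_le_of_le_one_left zero_le (ENNReal.inv_mul_le_one d)
  have hp0 : 0 ≤ 1 / p := by positivity
  exact ENNReal.rpow_le_rpow (iInf₂_le_of_le (κ + d⁻¹ • ρ₁.prod ρ₂) ⟨hc1, hc2⟩ hcost) hp0

/-- Split every cost at a level. Below `b`, respectively `B`, it is charged to the mass involved;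
above, to the excess, where a leftover marginal is dominated by the full one. -/
theorem wass_le_of_subcoupling (hp : 1 ≤ p) {μ ν : Measure ℝ} [IsProbabilityMeasure μ]
    [IsProbabilityMeasure ν] {κ : Measure (ℝ × ℝ)} (h1 : κ.map Prod.fst ≤ μ)
    (h2 : κ.map Prod.snd ≤ ν) {B b : ℝ} (hB : 0 ≤ B) (hb : 0 ≤ b) :
    wass p μ ν ≤ (ENNReal.ofReal ((2 * b) ^ p)
        + ENNReal.ofReal (2 ^ p) * ∫⁻ z, excess p b (z.1 - z.2) ∂κ
        + ENNReal.ofReal (2 ^ p) *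
          ((ENNReal.ofReal ((2 * B) ^ p) * (1 - κ Set.univ)
            + ENNReal.ofReal (2 ^ p) * ∫⁻ z, excess p B z ∂μ)
          + (ENNReal.ofReal ((2 * B) ^ p) * (1 - κ Set.univ)
            + ENNReal.ofReal (2 ^ p) * ∫⁻ z, excess p B z ∂ν))) ^ (1 / p) := by
  have hm1 : κ.map Prod.fst Set.univ = κ Set.univ := by
    rw [Measure.map_apply measurable_fst MeasurableSet.univ, Set.preimage_univ]
  have hm2 : κ.map Prod.snd Set.univ = κ Set.univ := by
    rw [Measure.map_apply measurable_snd MeasurableSet.univ, Set.preimage_univ]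
  have hκ1 : κ Set.univ ≤ 1 := by
    rw [← hm1]; exact (h1 _).trans_eq measure_univ
  have : IsFiniteMeasure κ := ⟨hκ1.trans_lt ENNReal.one_lt_top⟩
  have u1 : (μ - κ.map Prod.fst) Set.univ = 1 - κ Set.univ := by
    rw [Measure.sub_apply MeasurableSet.univ h1, hm1, measure_univ]
  have u2 : (ν - κ.map Prod.snd) Set.univ = 1 - κ Set.univ := by
    rw [Measure.sub_apply MeasurableSet.univ h2, hm2, measure_univ]
  have hbound (ρ μ : Measure ℝ) (hρ : ρ ≤ μ) (hu : ρ Set.univ = 1 - κ Set.univ) :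
      ∫⁻ z, ENNReal.ofReal (|z| ^ p) ∂ρ ≤ ENNReal.ofReal ((2 * B) ^ p) * (1 - κ Set.univ)
            + ENNReal.ofReal (2 ^ p) * ∫⁻ z, excess p B z ∂μ := by
    refine (lintegral_rpow_le_of_excess hp hB ρ).trans ?_
    rw [hu]
    gcongr
  have e1 : κ.map Prod.fst + (μ - κ.map Prod.fst) = μ := by
    rw [add_comm]; exact Measure.sub_add_cancel_of_le h1
  have e2 : κ.map Prod.snd + (ν - κ.map Prod.snd) = ν := by
    rw [add_comm]; exact Measure.sub_add_cancel_of_le h2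
  have hcost : ∫⁻ z, ENNReal.ofReal (|z.1 - z.2| ^ p) ∂κ ≤ ENNReal.ofReal ((2 * b) ^ p)
        + ENNReal.ofReal (2 ^ p) * ∫⁻ z, excess p b (z.1 - z.2) ∂κ := by
    have hpt (z : ℝ × ℝ) : ENNReal.ofReal (|z.1 - z.2| ^ p) ≤ ENNReal.ofReal ((2 * b) ^ p)
        + ENNReal.ofReal (2 ^ p) * excess p b (z.1 - z.2) := rpow_le_add_excess hp hb _
    have hme : Measurable fun z : ℝ × ℝ => excess p b (z.1 - z.2) := by fun_prop
    refine (lintegral_mono hpt).trans ?_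
    rw [lintegral_add_left measurable_const, lintegral_const, lintegral_const_mul _ hme]
    exact add_le_add ((mul_le_mul_right hκ1 _).trans_eq (mul_one _)) le_rfl
  have b1 := hbound _ _ (Measure.sub_le (μ := μ) (ν := κ.map Prod.fst)) u1
  have b2 := hbound _ _ (Measure.sub_le (μ := ν) (ν := κ.map Prod.snd)) u2
  have hd : 1 - κ Set.univ ≠ ⊤ := ne_top_of_le_ne_top ENNReal.one_ne_top tsub_le_self
  have hp0 : 0 ≤ 1 / p := by positivity
  refine (wass_le_of_add_eq hp e1 e2 hd u1 u2).trans (ENNReal.rpow_le_rpow ?_ hp0)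
  exact add_le_add hcost (mul_le_mul_right (add_le_add b1 b2) _)

end Coupling

namespace MDP

variable {X A : Type*} [MeasurableSpace X] [MeasurableSpace A] (M : MDP X A)

/-! ### Synchronous coupling with killing -/

section SubCoupling

theorem stepKernel_mono {π π' : Kernel X A} [IsSFiniteKernel π] [IsSFiniteKernel π']
    (h : ∀ x, π x ≤ π' x) (s : X × A) : M.stepKernel π s ≤ M.stepKernel π' s := by
  refine measure_le_of_lintegral_le fun f hf => ?_
  rw [M.lintegral_stepKernel π hf, M.lintegral_stepKernel π' hf]
  exact lintegral_mono fun x => lintegral_mono' (h x) le_rfl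

/-- One synchronous Bellman step of a pair of returns, the first of which pays the costs `k`. -/
theorem exists_coupled_step (π : Kernel X A) [IsSFiniteKernel π] {k : X → ℝ} (hk : Measurable k)
    (K : Kernel (X × A) (ℝ × ℝ)) [IsSFiniteKernel K] :
    ∃ K' : Kernel (X × A) (ℝ × ℝ), IsSFiniteKernel K' ∧ ∀ s, ∀ f : ℝ × ℝ → ℝ≥0∞, Measurable f →
      ∫⁻ z, f z ∂(K' s) = ∫⁻ s', ∫⁻ z, f (M.r s + M.γ * z.1 - M.γ * k s'.1, M.r s + M.γ * z.2)
        ∂(K s') ∂(M.stepKernel π s) := by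
  have := M.markov_P
  have hr := M.bddMeasurable_r.1
  have : IsSFiniteKernel (M.stepKernel π) := by unfold stepKernel; infer_instance
  set L := (M.stepKernel π).compProd (Kernel.prodMkLeft (X × A) K)
  let F : (X × A) × ((X × A) × (ℝ × ℝ)) → ℝ × ℝ := fun w =>
    (M.r w.1 + M.γ * w.2.2.1 - M.γ * k w.2.1.1, M.r w.1 + M.γ * w.2.2.2)
  have hF : Measurable F := by fun_prop
  refine ⟨(Kernel.id.prod L).map F, inferInstance, fun s f hf => ?_⟩
  rw [Kernel.map_apply _ hF, lintegral_map hf hF, Kernel.lintegral_id_prod (by fun_prop),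
    Kernel.lintegral_compProd _ _ _ (by fun_prop)]
  rfl

/-- The probability that a chain with transition kernel `k` survives `n` steps, when it survives the
step into `s` with probability `w s`. -/
noncomputable def survival {S : Type*} [MeasurableSpace S] (k : Kernel S S) (w : S → ℝ≥0∞) :
    ℕ → S → ℝ≥0∞
  | 0, _ => 1
  | n + 1, s => ∫⁻ s', w s' * survival k w n s' ∂(k s)

variable {πref π πs : Kernel X A} [IsMarkovKernel π] [IsMarkovKernel πs] {τ p b : ℝ}
  {ζ : Kernel (X × A) ℝ} {m : ℝ≥0∞}

/-- Synchronous sub-couplings of the soft evaluation iterates of `π` and of the returns of `πs`, as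
long as the actions agree. -/
theorem exists_subcoupling (hp : 1 ≤ p) (hk : Measurable (klCost πref τ π)) [IsMarkovKernel ζ]
    {w : X → ℝ≥0∞} (hw : Measurable w) (hw1 : ∀ x, w x ≤ 1) (hwπ : ∀ x, w x • πs x ≤ π x)
    (hb : ∀ x, |M.γ * klCost πref τ π x| ≤ (1 - M.γ) * b) (hb0 : 0 ≤ b)
    (hm : ∀ s, ∫⁻ z, ENNReal.ofReal (|z.1 - z.2| ^ p) ∂((ζ s).prod (M.returnDist πs s)) ≤ m)
    (n : ℕ) :
    IsMarkovKernel ((M.softEval πref τ π)^[n] ζ) ∧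
    ∃ K : Kernel (X × A) (ℝ × ℝ), IsSFiniteKernel K ∧
      (∀ s, (K s).map Prod.fst ≤ (M.softEval πref τ π)^[n] ζ s) ∧
      (∀ s, (K s).map Prod.snd ≤ M.returnDist πs s) ∧
      (∀ s, ∫⁻ z, excess p b (z.1 - z.2) ∂(K s) ≤ ENNReal.ofReal M.γ ^ n * m) ∧
      ∀ s, K s Set.univ = survival (M.stepKernel πs) (fun s => w s.1) n s := by
  have := M.markov_P
  have := M.isMarkovKernel_stepKernel πs
  have := M.isMarkovKernel_stepKernel π
  have := M.isMarkovKernel_returnDist πs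
  induction n with
  | zero =>
    -- Before any step the returns are coupled independently, with full mass.
    refine ⟨‹_›, ζ.prod (M.returnDist πs), inferInstance, fun s => ?_, fun s => ?_, fun s => ?_,
      fun s => ?_⟩
    · rw [Kernel.prod_apply, Measure.map_fst_prod]; simp
    · rw [Kernel.prod_apply, Measure.map_snd_prod]; simp
    · rw [Kernel.prod_apply, pow_zero, one_mul]
      exact (lintegral_mono fun z => excess_le_rpow hp hb0 _).trans (hm s)
    · simp [survival]
  | succ n ih =>
    rw [Function.iterate_succ_apply']
    obtain ⟨ih1, K, hK, hK1, hK2, hK3, hK4⟩ := ih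
    set ξ := (M.softEval πref τ π)^[n] ζ
    have hwm : Measurable (Function.uncurry fun (x : X) (_ : A) => w x) :=
      hw.comp measurable_fst
    -- The common part of the two policies. It lies below both, so one step driven by it keeps both
    -- marginals dominated.
    set πw : Kernel X A := Kernel.withDensity πs fun x _ => w x
    have hπw (x) : πw x = w x • πs x := by
      rw [Kernel.withDensity_apply _ hwm, withDensity_const]
    have h1 (x) : πw x ≤ π x := (hπw x).trans_le (hwπ x)
    have h2 (x) : πw x ≤ πs x := by
      rw [hπw]
      exact measure_le_of_lintegral_le fun f _ => by
        rw [lintegral_smul_measure]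
        exact mul_le_of_le_one_left zero_le (hw1 x)
    have hfin : IsFiniteKernel πw :=
      ⟨1, ENNReal.one_lt_top, fun x => (h2 x _).trans_eq measure_univ⟩
    obtain ⟨K', hK', hint⟩ := M.exists_coupled_step πw hk K
    refine ⟨M.isMarkovKernel_softEval hk, K', hK', fun s => ?_, fun s => ?_, fun s => ?_,
      fun s => ?_⟩
    · refine measure_le_of_lintegral_le fun f hf => ?_
      rw [lintegral_map hf measurable_fst, hint s _ (by fun_prop), M.lintegral_softEval hk hf]
      refine lintegral_mono' (M.stepKernel_mono h1 s) fun s' => ?_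
      refine le_trans (le_of_eq ?_) (lintegral_mono' (hK1 s') le_rfl)
      rw [lintegral_map (by fun_prop) measurable_fst]
    · refine measure_le_of_lintegral_le fun f hf => ?_
      rw [lintegral_map hf measurable_snd, hint s _ (by fun_prop), M.lintegral_returnDist πs hf]
      refine lintegral_mono' (M.stepKernel_mono h2 s) fun s' => ?_
      refine le_trans (le_of_eq ?_) (lintegral_mono' (hK2 s') le_rfl)
      rw [lintegral_map (by fun_prop) measurable_snd]
    · rw [hint s _ (by fun_prop)]
      calc _ ≤ ∫⁻ s', ENNReal.ofReal M.γ * (ENNReal.ofReal M.γ ^ n * m) ∂(M.stepKernel π s) := by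
            refine lintegral_mono' (M.stepKernel_mono h1 s) fun s' => ?_
            refine le_trans ?_ (mul_le_mul_right (hK3 s') _)
            rw [← lintegral_const_mul _ (by fun_prop)]
            refine lintegral_mono fun z => ?_
            -- The rewards cancel: the new difference of returns is `γ (z.1 - z.2)` minus the
            -- discounted KL cost, an affine map for which the level `b` is stable.
            have := excess_affine_le hp M.γ_pos M.γ_lt_one.le
              (b := -(M.γ * klCost πref τ π s'.1)) (by rw [abs_neg]; exact hb _) (z.1 - z.2)
            convert this using 2
            ring
        _ = _ := by simp [pow_succ', mul_assoc]
    · have hone := hint s 1 measurable_one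
      simp only [Pi.one_apply, lintegral_one] at hone
      simp_rw [hone, hK4]
      have hsm : Measurable (survival (M.stepKernel πs) (fun s => w s.1) n) := by
        have : (fun s => K s Set.univ) = survival (M.stepKernel πs) (fun s => w s.1) n :=
          funext hK4
        rw [← this]
        exact K.measurable_coe MeasurableSet.univ
      rw [survival, M.lintegral_stepKernel πw hsm, M.lintegral_stepKernel πs (by fun_prop)]
      refine lintegral_congr fun x => ?_
      rw [hπw, lintegral_smul_measure, smul_eq_mul]
      exact (lintegral_const_mul _ (by fun_prop)).symm

end SubCoupling

end MDP

namespace MDP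

variable {X A : Type*} [MeasurableSpace X] [MeasurableSpace A]

/-! ### Survival probabilities -/

section Survival

variable {S : Type*} [MeasurableSpace S] (k : Kernel S S)

theorem measurable_survival {w : S → ℝ≥0∞} (hw : Measurable w) (n : ℕ) :
    Measurable (survival k w n) := by
  induction n with
  | zero => exact measurable_const
  | succ n ih => exact (hw.mul ih).lintegral_kernel

variable [IsMarkovKernel k]

theorem survival_le_one {w : S → ℝ≥0∞} (hw : ∀ s, w s ≤ 1) (n : ℕ) (s : S) :
    survival k w n s ≤ 1 := by
  induction n generalizing s with
  | zero => exact le_rfl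
  | succ n ih =>
    refine (lintegral_mono fun s' => mul_le_mul' (hw s') (ih s')).trans_eq ?_
    simp

/-- Dominated convergence once per step. Nothing is uniform in `n` or `s`, which is why the horizon
must be fixed before the temperature. -/
theorem tendsto_survival {ι : Type*} {l : Filter ι} [l.IsCountablyGenerated]
    {w : ι → S → ℝ≥0∞} (hw : ∀ᶠ i in l, Measurable (w i)) (hw1 : ∀ᶠ i in l, ∀ s, w i s ≤ 1)
    (h : ∀ s, Tendsto (fun i => w i s) l (𝓝 1)) (n : ℕ) (s : S) :
    Tendsto (fun i => survival k (w i) n s) l (𝓝 1) := by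
  induction n generalizing s with
  | zero => exact tendsto_const_nhds
  | succ n ih =>
    have := tendsto_lintegral_filter_of_dominated_convergence (μ := k s) (l := l)
      (F := fun i s' => w i s' * survival k (w i) n s') (f := fun _ => 1) (fun _ => 1)
      (hw.mono fun i hi => hi.mul (measurable_survival k hi n))
      (hw1.mono fun i hi => ae_of_all _ fun s' =>
        (mul_le_mul' (hi s') (survival_le_one k hi n s')).trans_eq (mul_one 1))
      (by simp) (ae_of_all _ fun s' => by
        simpa using ENNReal.Tendsto.mul (h s') (by simp) (ih s') (by simp))
    simpa [survival] using this

end Survival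

/-! ### Overlap with the filtered policy -/

section Filtered

variable (πref : Kernel X A) [IsMarkovKernel πref] {q : X × A → ℝ}

theorem measurable_optActions_measure (hq : BddMeasurable q) :
    Measurable fun x => πref x (optActions πref q x) :=
  Kernel.measurable_kernel_prodMk_left (measurableSet_optActions_prod πref hq)

open Classical in
theorem filteredPolicy_apply (hq : BddMeasurable q) (x : X) :
    filteredPolicy πref q x = (πref x).withDensity fun a =>
      if a ∈ optActions πref q x then (πref x (optActions πref q x))⁻¹ else 0 := by
  refine Kernel.withDensity_apply _ ?_ _
  exact Measurable.ite (measurableSet_optActions_prod πref hq)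
    ((measurable_optActions_measure πref hq).inv.comp measurable_fst) measurable_const

theorem isMarkovKernel_filteredPolicy (hq : BddMeasurable q)
    (h : ∀ x, πref x (optActions πref q x) ≠ 0) : IsMarkovKernel (filteredPolicy πref q) := by
  classical
  refine ⟨fun x => ⟨?_⟩⟩
  have hS := measurableSet_optActions πref hq x
  rw [filteredPolicy_apply πref hq, withDensity_apply _ MeasurableSet.univ,
    Measure.restrict_univ]
  convert lintegral_indicator_const hS ((πref x (optActions πref q x))⁻¹) using 1
  · refine lintegral_congr fun a => ?_
    by_cases ha : a ∈ optActions πref q x <;> simp [ha]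
  · exact (ENNReal.inv_mul_cancel (h x) (measure_ne_top _ _)).symm

/-- A lower bound for the density of the Boltzmann-Gibbs policies of functions within `η` of `q`
with respect to the filtered policy of `q`. -/
noncomputable def overlap (τ η : ℝ) (q : X × A → ℝ) (x : X) : ℝ :=
  Real.exp (-(2 * η) / τ) *
    (Real.exp ((essSup (fun a => q (x, a)) (πref x) - softValue πref τ q x) / τ) *
      (πref x).real (optActions πref q x))

theorem measurable_overlap (hq : BddMeasurable q) (τ η : ℝ) :
    Measurable (overlap πref τ η q) := by
  have h1 := measurable_softValue πref hq τ
  have h2 := measurable_essSup_kernel πref hq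
  have h3 := (measurable_optActions_measure πref hq).ennreal_toReal
  exact ((Real.measurable_exp.comp ((h2.sub h1).div_const τ)).mul h3).const_mul _

/-- On the maximizers of `q`, `q'` loses at most `η` against `essSup q`, and its soft value gains at
most `η`; this gives the factor `exp (-2η/τ)`. The mass in `overlap` cancels the normalization of
the filtered density. -/
theorem overlap_smul_le (hq : BddMeasurable q) {q' : X × A → ℝ} (hq' : BddMeasurable q')
    {τ η : ℝ} (hτ : 0 < τ) (hη : ∀ s, |q' s - q s| ≤ η) {x : X}
    (h : πref x (optActions πref q x) ≠ 0) :
    ENNReal.ofReal (overlap πref τ η q x) • filteredPolicy πref q x ≤ boltzmann πref τ q' x := by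
  classical
  have hS := measurableSet_optActions πref hq x
  rw [filteredPolicy_apply πref hq, boltzmann_apply πref hq',
    ← withDensity_smul _ (by exact Measurable.ite hS measurable_const measurable_const)]
  refine withDensity_mono (ae_of_all _ fun a => ?_)
  rw [Pi.smul_apply, smul_eq_mul]
  split_ifs with ha
  · rw [overlap, ← mul_assoc, ENNReal.ofReal_mul (by positivity), ofReal_measureReal, mul_assoc,
      ENNReal.mul_inv_cancel h (measure_ne_top _ _), mul_one]
    refine ENNReal.ofReal_le_ofReal ?_
    rw [← Real.exp_add, ← add_div]
    refine Real.exp_le_exp.2 (div_le_div_of_nonneg_right ?_ hτ.le)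
    have h1 : q (x, a) = essSup (fun a => q (x, a)) (πref x) := ha
    have h2 := abs_le.1 (hη (x, a))
    have h3 := abs_le.1 (abs_softValue_sub_le πref hq' hq hτ fun a => hη (x, a))
    linarith [h2.1, h3.2]
  · simp

/-- Evaluate the domination for `q' = q` on the whole space, where both policies have mass one. -/
theorem overlap_le_one (hq : BddMeasurable q) {τ η : ℝ} (hτ : 0 < τ) (hη : 0 ≤ η)
    (h : ∀ x, πref x (optActions πref q x) ≠ 0) (x : X) :
    ENNReal.ofReal (overlap πref τ η q x) ≤ 1 := by
  have := isMarkovKernel_filteredPolicy πref hq h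
  have := isMarkovKernel_boltzmann πref hq hτ
  simpa using overlap_smul_le πref hq hq hτ (η := η) (fun s => by simpa using hη) (h x) Set.univ

/-- Laplace principle: the integrand is almost everywhere at most one and tends to the indicator of
the maximizers. -/
theorem tendsto_integral_exp_sub_essSup (hq : BddMeasurable q) (x : X) :
    Tendsto (fun τ : ℝ => ∫ a, Real.exp ((q (x, a) - essSup (fun a => q (x, a)) (πref x)) / τ)
      ∂(πref x)) (𝓝[>] 0) (𝓝 ((πref x).real (optActions πref q x))) := by
  obtain ⟨hm, C, hC⟩ := id hq
  have hS := measurableSet_optActions πref hq x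
  have hmx : Measurable fun a => q (x, a) := hm.comp measurable_prodMk_left
  have hle := ae_le_essSup_of_bound (μ := πref x) fun a => hC (x, a)
  set m := essSup (fun a => q (x, a)) (πref x)
  rw [← integral_indicator_one hS]
  refine tendsto_integral_filter_of_dominated_convergence (fun _ => 1)
    (Eventually.of_forall fun τ => Measurable.aestronglyMeasurable (by fun_prop)) ?_ (integrable_const _) ?_
  · filter_upwards [self_mem_nhdsWithin] with τ hτ
    filter_upwards [hle] with a ha
    rw [Real.norm_of_nonneg (Real.exp_pos _).le, Real.exp_le_one_iff]
    exact div_nonpos_of_nonpos_of_nonneg (by linarith) (le_of_lt hτ)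
  · filter_upwards [hle] with a ha
    by_cases h : q (x, a) = m
    · have : a ∈ optActions πref q x := h
      simp [this, h]
    · have hn : a ∉ optActions πref q x := h
      have hneg : q (x, a) - m < 0 := sub_neg.2 (lt_of_le_of_ne ha h)
      rw [Set.indicator_of_notMem hn]
      have hbot : Tendsto (fun τ : ℝ => (q (x, a) - m) / τ) (𝓝[>] 0) atBot := by
        simp_rw [div_eq_mul_inv]
        exact tendsto_inv_nhdsGT_zero.const_mul_atTop_of_neg hneg
      exact Real.tendsto_exp_atBot.comp hbot

/-- `overlap` is `exp (-2η/τ)` times the optimal mass divided by the integral of the previous lemma.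
The first factor is where the decoupling `η/τ → 0` is indispensable to the argument. -/
theorem tendsto_overlap (hq : BddMeasurable q) {x : X} (h : πref x (optActions πref q x) ≠ 0)
    {η : ℝ → ℝ} (hη : Tendsto (fun τ => η τ / τ) (𝓝[>] 0) (𝓝 0)) :
    Tendsto (fun τ => overlap πref τ (η τ) q x) (𝓝[>] 0) (𝓝 1) := by
  have hs : (πref x).real (optActions πref q x) ≠ 0 := by
    simpa [Measure.real, ENNReal.toReal_eq_zero_iff] using h
  have h1 : Tendsto (fun τ => Real.exp (-(2 * η τ) / τ)) (𝓝[>] 0) (𝓝 1) := by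
    rw [← Real.exp_zero]
    refine (Real.continuous_exp.tendsto 0).comp ?_
    convert hη.const_mul (-2) using 2
    · ring
    · simp
  have h2 := ((tendsto_integral_exp_sub_essSup πref hq x).inv₀ hs).mul_const
    ((πref x).real (optActions πref q x))
  rw [inv_mul_cancel₀ hs] at h2
  have h3 := h1.mul h2
  rw [mul_one] at h3
  refine h3.congr' ?_
  filter_upwards [self_mem_nhdsWithin] with τ hτ
  rw [overlap]
  congr 2
  have hτ0 : τ ≠ 0 := ne_of_gt hτ
  have hZ := integral_exp_div_pos πref hq τ x
  rw [sub_div, Real.exp_sub, softValue, mul_div_cancel_left₀ _ hτ0, Real.exp_log hZ]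
  simp_rw [sub_div, Real.exp_sub]
  rw [integral_div, inv_div]

end Filtered

/-! ### Wasserstein estimate for the evaluation iterates -/

section Wasserstein

variable (M : MDP X A) {πref : Kernel X A} [IsMarkovKernel πref] {p B R Q c η τ : ℝ} {m : ℝ≥0∞}

/-- The cost is `∫ q dπ - V_τ q`: the integral is at most `essSup qRef + η`, since the policy is
absolutely continuous, and the soft value is at least `essSup qRef - τ log c⁻¹ - η`. Unlike the
crude bound `2 * Q`, this vanishes with `τ` and `η`. -/
theorem klCost_boltzmann_le (hτ : 0 < τ) (hc : 0 < c)
    (hcov : ∀ x, ENNReal.ofReal c ≤ πref x (optActions πref (M.qRef πref) x))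
    {q : X × A → ℝ} (hq : BddMeasurable q) (hη : ∀ s, |q s - M.qRef πref s| ≤ η) (x : X) :
    klCost πref τ (boltzmann πref τ q) x ≤ τ * Real.log c⁻¹ + 2 * η := by
  have := isMarkovKernel_boltzmann πref hq hτ
  obtain ⟨hr, -⟩ := M.qRef_spec πref
  obtain ⟨C, hC⟩ := hr.2
  obtain ⟨D, hD⟩ := hq.2
  have h1 := integral_boltzmann_sub_klCost πref hq hτ x
  have h2 := abs_le.1 (M.abs_softValue_sub_essSup_le hτ hc hcov hq hη x)
  have hac : boltzmann πref τ q x ≪ πref x := by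
    rw [boltzmann_apply_eq_tilted πref hq hτ]; exact tilted_absolutelyContinuous _ _
  have hle : ∀ᵐ a ∂(boltzmann πref τ q x),
      q (x, a) ≤ essSup (fun a => M.qRef πref (x, a)) (πref x) + η := by
    refine hac.ae_le ?_
    filter_upwards [ae_le_essSup_of_bound (μ := πref x) fun a => hC (x, a)] with a ha
    linarith [(abs_le.1 (hη (x, a))).2]
  have hqi : Integrable (fun a => q (x, a)) (boltzmann πref τ q x) :=
    integrable_of_measurable_of_bound (hq.1.comp measurable_prodMk_left) fun a => hD (x, a)
  have h3 := integral_mono_ae hqi (integrable_const _) hle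
  simp only [integral_const, probReal_univ, one_smul] at h3
  linarith [h2.1]

/-- The evaluation iterates of a Boltzmann-Gibbs policy are close to the returns of the
optimality-filtered reference policy, up to the probability that the overlapping parts of the two
policies are left. -/
theorem wass_iterate_softEval_le (hp : 1 ≤ p) (hτ : 0 < τ) (hm : m ≠ ⊤) (hB0 : 0 ≤ B)
    (hR : ∀ s, |M.r s| ≤ R) (hRB : R / (1 - M.γ) ≤ B) (hB : R + M.γ * (2 * Q) ≤ (1 - M.γ) * B)
    (hc : 0 < c) (hc1 : c ≤ 1)
    (hcov : ∀ x, ENNReal.ofReal c ≤ πref x (optActions πref (M.qRef πref) x))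
    {ζ : Kernel (X × A) ℝ} (hζ : IsMarkovKernel ζ) (h₀ : ∀ s, ∫⁻ z, excess p B z ∂(ζ s) ≤ m)
    (hQ : ∀ s, |meanFn ζ s| ≤ Q) (hη0 : 0 ≤ η) (hη : ∀ s, |meanFn ζ s - M.qRef πref s| ≤ η)
    (n : ℕ) (s : X × A) :
    wass p ((M.softEval πref τ (boltzmann πref τ (meanFn ζ)))^[n] ζ s)
        (M.returnDist (M.optFilteredPolicy πref) s)
      ≤ (ENNReal.ofReal ((2 * (M.γ * (τ * Real.log c⁻¹ + 2 * η) / (1 - M.γ))) ^ p)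
        + ENNReal.ofReal M.γ ^ n * (ENNReal.ofReal (2 ^ p) * (ENNReal.ofReal (2 ^ p) *
          (2 * ENNReal.ofReal ((2 * B) ^ p) + ENNReal.ofReal (2 ^ p) * m))
          + ENNReal.ofReal (2 ^ p) * (ENNReal.ofReal (2 ^ p) * m))
        + ENNReal.ofReal (2 ^ p) * (2 * ENNReal.ofReal ((2 * B) ^ p)) *
          (1 - survival (M.stepKernel (M.optFilteredPolicy πref))
            (fun s => ENNReal.ofReal (overlap πref τ η (M.qRef πref) s.1)) n s)) ^ (1 / p) := by
  have hγ0 := M.γ_pos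
  have hγ1 : 0 < 1 - M.γ := sub_pos.2 M.γ_lt_one
  obtain ⟨hr, -⟩ := M.qRef_spec πref
  have hne (x) : πref x (optActions πref (M.qRef πref) x) ≠ 0 :=
    fun h => (ENNReal.ofReal_pos.2 hc).not_ge (h ▸ hcov x)
  have hπs : IsMarkovKernel (M.optFilteredPolicy πref) :=
    isMarkovKernel_filteredPolicy πref hr hne
  have hq := bddMeasurable_meanFn fun s => lintegral_enorm_le_of_excess hp hB0 hm (h₀ s)
  have hπ := isMarkovKernel_boltzmann πref hq hτ
  have hk := measurable_klCost_boltzmann πref hq hτ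
  have hL : 0 ≤ τ * Real.log c⁻¹ :=
    mul_nonneg hτ.le (Real.log_nonneg ((one_le_inv₀ hc).2 hc1))
  -- The total discounted KL cost: the level left stable by the recursion for the difference of
  -- returns.
  set b := M.γ * (τ * Real.log c⁻¹ + 2 * η) / (1 - M.γ) with hbdef
  have hb0 : 0 ≤ b := by positivity
  have hb (x) : |M.γ * klCost πref τ (boltzmann πref τ (meanFn ζ)) x| ≤ (1 - M.γ) * b := by
    rw [hbdef, mul_div_cancel₀ _ hγ1.ne', abs_mul, abs_of_pos hγ0,
      abs_of_nonneg (klCost_nonneg πref hτ _ x)]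
    exact mul_le_mul_of_nonneg_left (M.klCost_boltzmann_le hτ hc hcov hq hη x) hγ0.le
  have := M.isMarkovKernel_returnDist (M.optFilteredPolicy πref)
  have hret (s) : ∫⁻ z, excess p B z ∂(M.returnDist (M.optFilteredPolicy πref) s) = 0 := by
    rw [lintegral_eq_zero_iff (by fun_prop)]
    exact (M.ae_abs_le_returnDist _ hR s).mono fun z hz => excess_eq_zero hp (hz.trans hRB)
  have hm3 (s) : ∫⁻ z, ENNReal.ofReal (|z.1 - z.2| ^ p)
      ∂((ζ s).prod (M.returnDist (M.optFilteredPolicy πref) s))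
      ≤ ENNReal.ofReal (2 ^ p) *
        (2 * ENNReal.ofReal ((2 * B) ^ p) + ENNReal.ofReal (2 ^ p) * m) := by
    refine (lintegral_prod_abs_sub_rpow_le hp _ _).trans (mul_le_mul_right ?_ _)
    have h1 := lintegral_rpow_le_of_excess hp hB0 (ζ s)
    have h2 := lintegral_rpow_le_of_excess hp hB0 (M.returnDist (M.optFilteredPolicy πref) s)
    rw [hret, mul_zero, add_zero] at h2
    simp only [measure_univ, mul_one] at h1 h2 ⊢
    refine (add_le_add (h1.trans (add_le_add le_rfl (mul_le_mul_right (h₀ s) _))) h2).trans_eq ?_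
    ring
  obtain ⟨hMn, K, -, hK1, hK2, hK3, hK4⟩ := M.exists_subcoupling
    (πs := M.optFilteredPolicy πref) hp hk
    (measurable_overlap πref hr τ η).ennreal_ofReal (overlap_le_one πref hr hτ hη0 hne)
    (fun x => overlap_smul_le πref hr hq hτ hη (hne x)) hb hb0 hm3 n
  have hex := (M.iterate_softEval_spec hp hτ hm hB0 hR hB hc hc1 hcov hζ h₀ hQ hη0 hη n).2.1 s
  have hw := wass_le_of_subcoupling hp (hK1 s) (hK2 s) hB0 hb0
  rw [hret, hK4] at hw
  have hp0 : 0 ≤ 1 / p := by positivity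
  refine hw.trans (ENNReal.rpow_le_rpow ?_ hp0)
  calc _ ≤ ENNReal.ofReal ((2 * b) ^ p) + ENNReal.ofReal (2 ^ p) * (ENNReal.ofReal M.γ ^ n *
          (ENNReal.ofReal (2 ^ p) *
            (2 * ENNReal.ofReal ((2 * B) ^ p) + ENNReal.ofReal (2 ^ p) * m)))
        + ENNReal.ofReal (2 ^ p) *
          ((ENNReal.ofReal ((2 * B) ^ p) * (1 - survival (M.stepKernel (M.optFilteredPolicy πref))
            (fun s => ENNReal.ofReal (overlap πref τ η (M.qRef πref) s.1)) n s)
            + ENNReal.ofReal (2 ^ p) * (ENNReal.ofReal M.γ ^ n * m))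
          + (ENNReal.ofReal ((2 * B) ^ p) * (1 - survival (M.stepKernel (M.optFilteredPolicy πref))
            (fun s => ENNReal.ofReal (overlap πref τ η (M.qRef πref) s.1)) n s)
            + ENNReal.ofReal (2 ^ p) * 0)) := by
        gcongr
        exact hK3 s
    _ = _ := by ring

end Wasserstein

end MDP

/-! ### Averaging over the initial pair, and the choice of parameters -/

theorem avgWass_le_of_wass_le {Y : Type*} [MeasurableSpace Y] {p p' : ℝ} (hp' : 1 ≤ p')
    (ϖ : Measure Y) {ζ ζ' : Kernel Y ℝ} {F : Y → ℝ≥0∞}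
    (h : ∀ y, wass p (ζ y) (ζ' y) ≤ F y ^ (1 / p)) :
    avgWass p p' ϖ ζ ζ' ≤ (∫⁻ y, F y ^ (1 / p * p') ∂ϖ) ^ (1 / p') := by
  have hp0 : 0 ≤ p' := by linarith
  refine ENNReal.rpow_le_rpow (lintegral_mono fun y => ?_) (by positivity)
  rw [ENNReal.rpow_mul]
  exact ENNReal.rpow_le_rpow (h y) hp0

/-- Pointwise survival suffices here because `ϖ` is finite and the integrands are eventually bounded
by a constant. -/
theorem tendsto_lintegral_rpow_affine {Y ι : Type*} [MeasurableSpace Y] (ϖ : Measure Y)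
    [IsProbabilityMeasure ϖ] {l : Filter ι} [l.IsCountablyGenerated] {p p' : ℝ} (hp : 1 ≤ p)
    (hp' : 1 ≤ p') {e : ι → ℝ≥0∞} (he : Tendsto e l (𝓝 0)) {g a : ℝ≥0∞} (hg : g ≠ ⊤) (ha : a ≠ ⊤)
    {u : ι → Y → ℝ≥0∞} (hu : ∀ᶠ i in l, Measurable (u i))
    (hlim : ∀ y, Tendsto (fun i => u i y) l (𝓝 1)) :
    Tendsto (fun i => (∫⁻ y, (e i + g + a * (1 - u i y)) ^ (1 / p * p') ∂ϖ) ^ (1 / p')) l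
      (𝓝 (g ^ (1 / p))) := by
  have hp0 : 0 < 1 / p * p' := by positivity
  have hmain : Tendsto (fun i => ∫⁻ y, (e i + g + a * (1 - u i y)) ^ (1 / p * p') ∂ϖ) l
      (𝓝 (∫⁻ _, g ^ (1 / p * p') ∂ϖ)) := by
    refine tendsto_lintegral_filter_of_dominated_convergence
      (fun _ => (1 + g + a) ^ (1 / p * p')) ?_ ?_ ?_ ?_
    · filter_upwards [hu] with i hi
      fun_prop
    · filter_upwards [he.eventually (ge_mem_nhds one_pos)] with i hi
      refine ae_of_all _ fun y => ENNReal.rpow_le_rpow ?_ hp0.le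
      gcongr
      exact (mul_le_mul_right tsub_le_self _).trans_eq (mul_one _)
    · rw [lintegral_const, measure_univ, mul_one]
      exact ENNReal.rpow_ne_top_of_nonneg hp0.le (by simp [hg, ha])
    · refine ae_of_all _ fun y => ?_
      refine ((ENNReal.continuous_rpow_const (y := 1 / p * p')).tendsto g).comp ?_
      have h1 : Tendsto (fun i => 1 - u i y) l (𝓝 (1 - 1)) :=
        ENNReal.Tendsto.sub tendsto_const_nhds (hlim y) (Or.inl ENNReal.one_ne_top)
      have h2 := (he.add_const g).add (ENNReal.Tendsto.const_mul h1 (Or.inr ha))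
      simpa using h2
  rw [lintegral_const, measure_univ, mul_one] at hmain
  have h := ((ENNReal.continuous_rpow_const (y := 1 / p')).tendsto _).comp hmain
  rw [← ENNReal.rpow_mul, mul_assoc, mul_one_div_cancel (by positivity), mul_one] at h
  exact h

theorem mainTheorem3 {X A : Type*} [MeasurableSpace X] [StandardBorelSpace X]
    [MeasurableSpace A] [Countable A] [DiscreteMeasurableSpace A]
    (M : MDP X A) (πref : Kernel X A) [IsMarkovKernel πref] (hcov : M.Coverage πref)
    (p p' : ℝ) (hp : 1 ≤ p) (hp' : 1 ≤ p')
    (ϖ : Measure (X × A)) [IsProbabilityMeasure ϖ]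
    (ε δ : ℝ) (hε : 0 < ε) (hδ : 0 < δ)
    (ζ₀ : Kernel (X × A) ℝ) (hζ₀ : HasBoundedMoment p ζ₀)
    (σ : ℝ → ℝ) (hσ : IsDecoupling σ) :
    ∃ τ : ℝ, 0 < τ ∧ ∃ nOpt nEval : ℕ,
      avgWass p p' ϖ (M.decoupledIterate πref τ (σ τ) ζ₀ nOpt nEval)
          (M.returnDist (M.optFilteredPolicy πref)) ≤ ENNReal.ofReal δ ∧
      M.IsRefOptimal πref ε
        (MDP.boltzmann πref τ (meanFn (M.decoupledIterate πref τ (σ τ) ζ₀ nOpt nEval))) := by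
  obtain ⟨c, hc, hsoft⟩ := hcov
  obtain ⟨hζM, hζsup⟩ := hζ₀
  obtain ⟨hσ0, hστ⟩ := hσ
  have hcov := MDP.coverage_qRef hc hsoft
  obtain ⟨hr, -⟩ := M.qRef_spec πref
  obtain ⟨s₀⟩ := nonempty_of_isProbabilityMeasure ϖ
  have hc1 : c ≤ 1 := by
    have := (hcov s₀.1).trans prob_le_one
    rwa [ENNReal.ofReal_le_one] at this
  have hγ0 := M.γ_pos
  have hγ1 : 0 < 1 - M.γ := sub_pos.2 M.γ_lt_one
  set m := ⨆ s, ∫⁻ z, ENNReal.ofReal (|z| ^ p) ∂(ζ₀ s)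
  have hm : m ≠ ⊤ := hζsup.ne
  have hex (B : ℝ) (hB : 0 ≤ B) (s) : ∫⁻ z, excess p B z ∂(ζ₀ s) ≤ m :=
    (lintegral_mono (excess_le_rpow hp hB)).trans
      (le_iSup (fun s => ∫⁻ z, ENNReal.ofReal (|z| ^ p) ∂(ζ₀ s)) s)
  have hq₀ := MDP.bddMeasurable_meanFn fun s => lintegral_enorm_le_of_excess hp le_rfl hm
    (hex 0 le_rfl s)
  obtain ⟨R, hR⟩ := M.bddMeasurable_r.2
  obtain ⟨C₀, hC₀⟩ := hq₀.2
  have hR0 : 0 ≤ R := (abs_nonneg _).trans (hR s₀)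
  have hC0 : 0 ≤ C₀ := (abs_nonneg _).trans (hC₀ s₀)
  -- `C₀` covers the initial means and `R / (1 - γ)` makes the range `[-Q, Q]` stable under soft
  -- Bellman steps.
  obtain ⟨Q, hQdef⟩ : ∃ Q, Q = C₀ + R / (1 - M.γ) := ⟨_, rfl⟩
  -- Chosen so that `(1 - γ) B` absorbs one reward and a KL cost of at most `2 * Q`.
  obtain ⟨B, hBdef⟩ : ∃ B, B = (R + 2 * Q) / (1 - M.γ) := ⟨_, rfl⟩
  have hRγ : 0 ≤ R / (1 - M.γ) := by positivity
  have hQ0 : 0 ≤ Q := by linarith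
  have hQ₀ (s) : |meanFn ζ₀ s| ≤ Q := (hC₀ s).trans (by linarith)
  have hQ : R + M.γ * Q ≤ Q := by
    have : (1 - M.γ) * (R / (1 - M.γ)) = R := mul_div_cancel₀ _ hγ1.ne'
    have := mul_nonneg hγ1.le hC0
    rw [hQdef]; linarith
  have hBe : (1 - M.γ) * B = R + 2 * Q := by rw [hBdef]; exact mul_div_cancel₀ _ hγ1.ne'
  have hB0 : 0 ≤ B := by rw [hBdef]; positivity
  have hB : R + M.γ * (2 * Q) ≤ (1 - M.γ) * B := by
    rw [hBe]; have := mul_nonneg hγ1.le hQ0; linarith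
  have hRB : R / (1 - M.γ) ≤ B := by
    rw [hBdef]; exact div_le_div_of_nonneg_right (by linarith) hγ1.le
  have hLog : 0 ≤ Real.log c⁻¹ := Real.log_nonneg ((one_le_inv₀ hc).2 hc1)
  -- In units of `σ τ`: `1` for stopping the control iteration, the rest for the bias of `qSoft`.
  obtain ⟨C, hCdef⟩ : ∃ C, C = 1 + M.γ * Real.log c⁻¹ / (1 - M.γ) := ⟨_, rfl⟩
  have hCpos : 0 ≤ C := by rw [hCdef]; positivity
  -- the number of evaluation steps
  set E := ENNReal.ofReal (2 ^ p) * (ENNReal.ofReal (2 ^ p) *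
          (2 * ENNReal.ofReal ((2 * B) ^ p) + ENNReal.ofReal (2 ^ p) * m))
          + ENNReal.ofReal (2 ^ p) * (ENNReal.ofReal (2 ^ p) * m)
  have hE : E ≠ ⊤ := by finiteness
  obtain ⟨N, hN⟩ : ∃ N : ℕ, (ENNReal.ofReal M.γ ^ N * E) ^ (1 / p) < ENNReal.ofReal δ := by
    have h1 : Tendsto (fun n : ℕ => ENNReal.ofReal M.γ ^ n * E) atTop (𝓝 0) := by
      simpa using ENNReal.Tendsto.mul_const (ENNReal.tendsto_pow_atTop_nhds_zero_of_lt_one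
        (by simpa using M.γ_lt_one)) (Or.inr hE)
    have h2 := ((ENNReal.continuous_rpow_const (y := 1 / p)).tendsto 0).comp h1
    rw [ENNReal.zero_rpow_of_pos (by positivity)] at h2
    exact (h2.eventually (gt_mem_nhds (ENNReal.ofReal_pos.2 hδ))).exists
  -- the temperature
  have hσlim : Tendsto σ (𝓝[>] 0) (𝓝 0) := by
    have h1 := hστ.mul (tendsto_id.mono_left nhdsWithin_le_nhds : Tendsto id (𝓝[>] (0 : ℝ)) (𝓝 0))
    rw [mul_zero] at h1
    refine h1.congr' ?_
    filter_upwards [self_mem_nhdsWithin] with τ hτ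
    exact div_mul_cancel₀ _ (ne_of_gt hτ)
  have hτlim : Tendsto (fun τ : ℝ => τ) (𝓝[>] 0) (𝓝 0) := nhdsWithin_le_nhds
  have hDlim : Tendsto (fun τ => τ * Real.log c⁻¹ + 2 * (C * σ τ)) (𝓝[>] 0) (𝓝 0) := by
    simpa using (hτlim.mul_const (Real.log c⁻¹)).add ((hσlim.const_mul C).const_mul 2)
  -- The accuracy of the evaluated means takes the place of `η` in the optimality bound.
  have hεlim : Tendsto (fun τ => M.γ * (τ * Real.log c⁻¹ + 2 *
      ((τ * Real.log c⁻¹ + 2 * (C * σ τ)) / (1 - M.γ))) / (1 - M.γ)) (𝓝[>] 0) (𝓝 0) := by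
    simpa using (((hτlim.mul_const (Real.log c⁻¹)).add
      ((hDlim.div_const (1 - M.γ)).const_mul 2)).const_mul M.γ).div_const (1 - M.γ)
  have helim : Tendsto (fun τ => ENNReal.ofReal ((2 * (M.γ * (τ * Real.log c⁻¹ + 2 * (C * σ τ))
      / (1 - M.γ))) ^ p)) (𝓝[>] 0) (𝓝 0) := by
    have h1 := (((hDlim.const_mul M.γ).div_const (1 - M.γ)).const_mul 2).rpow_const
      (p := p) (Or.inr (by linarith))
    rw [mul_zero, zero_div, mul_zero, Real.zero_rpow (by linarith)] at h1
    simpa using ENNReal.tendsto_ofReal h1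
  have hne (x) : πref x (MDP.optActions πref (M.qRef πref) x) ≠ 0 :=
    fun h => (ENNReal.ofReal_pos.2 hc).not_ge (h ▸ hcov x)
  have hπs : IsMarkovKernel (M.optFilteredPolicy πref) :=
    MDP.isMarkovKernel_filteredPolicy πref hr hne
  have hstep := M.isMarkovKernel_stepKernel (M.optFilteredPolicy πref)
  have hwm (τ : ℝ) : Measurable fun s : X × A =>
      ENNReal.ofReal (MDP.overlap πref τ (C * σ τ) (M.qRef πref) s.1) :=
    ((MDP.measurable_overlap πref hr _ _).comp measurable_fst).ennreal_ofReal
  have hsurv (s : X × A) := MDP.tendsto_survival (M.stepKernel (M.optFilteredPolicy πref))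
    (l := 𝓝[>] (0 : ℝ)) (Eventually.of_forall hwm)
    (eventually_mem_nhdsWithin.mono fun τ hτ s => MDP.overlap_le_one πref hr hτ
      (mul_nonneg hCpos (hσ0 τ hτ).le) hne s.1)
    (fun s => by
      have hη : Tendsto (fun τ => C * σ τ / τ) (𝓝[>] 0) (𝓝 0) := by
        simpa [mul_div_assoc] using hστ.const_mul C
      simpa using ENNReal.tendsto_ofReal (MDP.tendsto_overlap πref hr (hne s.1) hη)) N s
  have havg := tendsto_lintegral_rpow_affine ϖ hp hp' helim
    (g := ENNReal.ofReal M.γ ^ N * E)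
    (a := ENNReal.ofReal (2 ^ p) * (2 * ENNReal.ofReal ((2 * B) ^ p))) (by finiteness)
    (by finiteness) (Eventually.of_forall fun τ => MDP.measurable_survival _ (hwm τ) N) hsurv
  -- With `N` fixed, the averaged bound tends to the geometric term alone, which is already below
  -- `δ`.
  obtain ⟨τ, hτδ, hτε, hτ⟩ := ((havg.eventually (gt_mem_nhds hN)).and
    ((hεlim.eventually (gt_mem_nhds hε)).and eventually_mem_nhdsWithin)).exists
  have hτ0 : 0 < τ := hτ
  have hστ0 := hσ0 τ hτ0
  -- the number of control steps
  obtain ⟨n, hn⟩ := M.exists_abs_iterate_softBellman_sub_le πref hστ0 hq₀ hστ0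
  obtain ⟨hζn, hexn, hQn, hmeann⟩ := M.controlIterate_spec πref hp hστ0 hm hB0 hR hQ hB hζM
    (hex B hB0) hQ₀ n
  have hη (s) : |meanFn (M.controlIterate πref (σ τ) ζ₀ n) s - M.qRef πref s| ≤ C * σ τ := by
    rw [hmeann]
    refine (abs_sub_le _ (M.qSoft πref (σ τ) s) _).trans ((add_le_add (hn s)
      (MDP.abs_qSoft_sub_qRef_le hc hστ0 (hsoft _ hστ0) s)).trans_eq ?_)
    rw [hCdef]; ring
  have hη0 : 0 ≤ C * σ τ := mul_nonneg hCpos hστ0.le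
  obtain ⟨hMN, hexN, hDN⟩ := M.iterate_softEval_spec hp hτ0 hm hB0 hR hB hc hc1 hcov hζn hexn hQn
    hη0 hη N
  refine ⟨τ, hτ0, n, N, ?_, ?_⟩
  · refine (avgWass_le_of_wass_le hp' ϖ fun s => M.wass_iterate_softEval_le hp hτ0 hm hB0 hR hRB hB
      hc hc1 hcov hζn hexn hQn hη0 hη N s).trans hτδ.le
  · have hmN : ENNReal.ofReal M.γ ^ N * m ≠ ⊤ := by finiteness
    have hqN := MDP.bddMeasurable_meanFn fun s => lintegral_enorm_le_of_excess hp hB0 hmN (hexN s)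
    obtain ⟨h1, h2⟩ := M.isRefOptimal_boltzmann hτ0 hc hcov hqN hDN
    exact ⟨h1, fun s => (by linarith [hτε] : _ ≤ _).trans (h2 s)⟩
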